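/- Let $\mathcal C=\{0,1\}^{\mathbb N}$ with its product topology, let $\nu$ be the product of the uniform probability measures on $\{0,1\}$, and let $c\ge 0$. Let $\mathcal M_c^+$ be the set of symmetric Borel measures $\mu$ on $\mathcal C\times\mathcal C$ with $\mu(\mathcal C\times\mathcal C)\le c$. For $\mu\in\mathcal M_c^+$ and an integer $k\ge 1$, the $k$-shape $C(\mu,k)\subset\mathbb R^{k\times k}$ is the closure of the set of all matrices $\big(\int f_i(x)f_j(y)\,d\mu(x,y)\big)_{i,j=1}^k$, where $f_1,\dots,f_k$ are nonnegative Borel functions on $\mathcal C$ with $\sum_i f_i=1$ everywhere and $\int f_i\,d\nu=1/k$ for each $i$. Let $D_k$ be the Hausdorff metric on nonempty compact subsets of $\mathbb R^{k\times k}$ for the $\ell_1$ norm, and put $$d_S(\mu_1,\mu_2)=\sum_{k=1}^{\infty}2^{-k}D_k\big(C(\mu_1,k),C(\mu_2,k)\big).$$ For an $n\times n$ real matrix $S$ ($n\ge1$) let $\gamma(S)$ be the sum of its entries and $C(S,k)=\{MSM^T\}$, where $M$ ranges over the nonnegative $k\times n$ matrices with all row sums $n/k$ and all column sums $1$. Proposition.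 (1) The series defining $d_S$ converges, and $d_S$ is a pseudometric on $\mathcal M_c^+$. (2) The quotient of $\mathcal M_c^+$ by the relation $d_S(\mu_1,\mu_2)=0$, with the metric induced by $d_S$, is a compact Hausdorff space. (3) If $(S_i)$ is a sequence of nonnegative symmetric matrices (of arbitrary sizes) with $\gamma(S_i)\le c$ such that for every $k\ge1$ the shapes $C(S_i,k)$ converge in $D_k$ to some nonempty compact set, then there is $\mu\in\mathcal M_c^+$ with $C(S_i,k)\to C(\mu,k)$ in $D_k$ for every $k\ge1$. (4) For every $\mu\in\mathcal M_c^+$ there is a sequence $(S_i)$ of nonnegative symmetric matrices with $\gamma(S_i)=\mu(\mathcal C\times\mathcal C)$ and $C(S_i,k)\to C(\mu,k)$ in $D_k$ for every $k\ge1$. -/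

import Mathlib

open MeasureTheory Filter Topology TopologicalSpace
open scoped NNReal ENNReal

noncomputable section

namespace ShapeSpace

/-- The Cantor set `{0,1}^ℕ`, with its product topology and Borel σ-algebra. -/
abbrev Cantor : Type := ℕ → Bool

/-- The product over `ℕ` of the uniform measure on `{0,1}`. -/
def cantorMeasure : Measure Cantor :=
  Measure.infinitePi (fun _ : ℕ => (PMF.uniformOfFintype Bool).toMeasure)

instance : IsProbabilityMeasure cantorMeasure := by
  unfold cantorMeasure; infer_instance

/-- `ℝ^{k×k}` with the `ℓ¹` norm. -/
abbrev EllOneMat (k : ℕ) : Type := PiLp 1 (fun _ : Fin k × Fin k => ℝ)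

/-- Measurable fractional partitions of the Cantor set into `k` parts of equal weight. -/
structure IsFractionalPartition (k : ℕ) (f : Fin k → Cantor → ℝ) : Prop where
  measurable : ∀ i, Measurable (f i)
  nonneg : ∀ i x, 0 ≤ f i x
  sum_eq_one : ∀ x, ∑ i, f i x = 1
  integral_eq : ∀ i, ∫ x, f i x ∂cantorMeasure = 1 / (k : ℝ)

/-- The `k × k` matrix with entries `∫ f_i(x) f_j(y) dμ(x,y)`. -/
def quotientMatrix (μ : Measure (Cantor × Cantor)) {k : ℕ} (f : Fin k → Cantor → ℝ) :
    EllOneMat k :=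
  WithLp.toLp 1 fun q => ∫ p, f q.1 p.1 * f q.2 p.2 ∂μ

/-- The set `C_0(μ,k)` of all quotient matrices of `μ`. -/
def preShape (μ : Measure (Cantor × Cantor)) (k : ℕ) : Set (EllOneMat k) :=
  {X | ∃ f : Fin k → Cantor → ℝ, IsFractionalPartition k f ∧ X = quotientMatrix μ f}

theorem preShape_nonempty (μ : Measure (Cantor × Cantor)) (k : ℕ) [NeZero k] :
    (preShape μ k).Nonempty := by
  have hk : (k : ℝ) ≠ 0 := Nat.cast_ne_zero.mpr (NeZero.ne k)
  refine ⟨_, fun _ _ => 1 / (k : ℝ), ⟨fun i => measurable_const, fun i x => by positivity,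
    fun x => ?_, fun i => by simp⟩, rfl⟩
  simp [hk]

theorem IsFractionalPartition.le_one {k : ℕ} {f : Fin k → Cantor → ℝ}
    (hf : IsFractionalPartition k f) (i : Fin k) (x : Cantor) : f i x ≤ 1 := by
  rw [← hf.sum_eq_one x]
  exact Finset.single_le_sum (f := fun i => f i x) (fun j _ => hf.nonneg j x) (Finset.mem_univ i)

theorem preShape_bounded (μ : Measure (Cantor × Cantor)) [IsFiniteMeasure μ] (k : ℕ) :
    Bornology.IsBounded (preShape μ k) := by
  rw [isBounded_iff_forall_norm_le]
  refine ⟨∑ _q : Fin k × Fin k, μ.real Set.univ, ?_⟩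
  rintro X ⟨f, hf, rfl⟩
  have h1 := PiLp.norm_eq_of_L1 (quotientMatrix μ f)
  rw [h1]
  refine Finset.sum_le_sum fun q _ => ?_
  refine (norm_integral_le_of_norm_le_const (C := 1) (Eventually.of_forall fun p => ?_)).trans ?_
  · rw [Real.norm_eq_abs, abs_of_nonneg (mul_nonneg (hf.nonneg _ _) (hf.nonneg _ _))]
    exact mul_le_one₀ (hf.le_one _ _) (hf.nonneg _ _) (hf.le_one _ _)
  · simp

/-- The `k`-shape `C(μ,k)` of a finite measure: the closure of `C_0(μ,k)`, as a point of the space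
of nonempty compact subsets of `ℝ^{k×k}` with the Hausdorff metric. -/
def shape (μ : Measure (Cantor × Cantor)) [IsFiniteMeasure μ] (k : ℕ) [NeZero k] :
    NonemptyCompacts (EllOneMat k) where
  carrier := closure (preShape μ k)
  isCompact' :=
    haveI : ProperSpace (EllOneMat k) := FiniteDimensional.proper ℝ _
    (preShape_bounded μ k).isCompact_closure
  nonempty' := (preShape_nonempty μ k).closure

/-- The symmetric Borel measures on `𝒞 × 𝒞` of total mass at most `c`. -/
def SymMeasure (c : ℝ≥0) : Type :=
  {μ : Measure (Cantor × Cantor) // μ.map Prod.swap = μ ∧ μ Set.univ ≤ (c : ℝ≥0∞)}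

/-- The underlying measure. -/
def SymMeasure.meas {c : ℝ≥0} (μ : SymMeasure c) : Measure (Cantor × Cantor) := μ.1

instance {c : ℝ≥0} (μ : SymMeasure c) : IsFiniteMeasure μ.meas :=
  ⟨μ.2.2.trans_lt ENNReal.coe_lt_top⟩

/-- The terms `2^{-k} D_k(C(μ₁,k), C(μ₂,k))`, `k ≥ 1`, indexed by `m = k - 1`. -/
def shapeDistTerm {c : ℝ≥0} (μ₁ μ₂ : SymMeasure c) (m : ℕ) : ℝ :=
  1 / 2 ^ (m + 1) * dist (shape μ₁.meas (m + 1)) (shape μ₂.meas (m + 1))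

/-- The shape distance `d_S(μ₁,μ₂) = ∑_{k ≥ 1} 2^{-k} D_k(C(μ₁,k), C(μ₂,k))`. -/
def shapeDist {c : ℝ≥0} (μ₁ μ₂ : SymMeasure c) : ℝ := ∑' m : ℕ, shapeDistTerm μ₁ μ₂ m

/-- The nonnegative `k × n` matrices with row sums `n/k` and column sums `1`. -/
def balancedMatrices (k n : ℕ) : Set (Matrix (Fin k) (Fin n) ℝ) :=
  {M | (∀ i j, 0 ≤ M i j) ∧ (∀ i, ∑ j, M i j = (n : ℝ) / k) ∧ ∀ j, ∑ i, M i j = 1}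

/-- The set of all `M S Mᵀ` with `M` a balanced `k × n` matrix. -/
def matrixShapeSet {n : ℕ} (S : Matrix (Fin n) (Fin n) ℝ) (k : ℕ) : Set (EllOneMat k) :=
  (fun M : Matrix (Fin k) (Fin n) ℝ => WithLp.toLp 1 fun q => (M * S * M.transpose) q.1 q.2) ''
    balancedMatrices k n

theorem balancedMatrices_nonempty (k n : ℕ) [NeZero k] : (balancedMatrices k n).Nonempty := by
  have hk : (k : ℝ) ≠ 0 := Nat.cast_ne_zero.mpr (NeZero.ne k)
  refine ⟨fun _ _ => 1 / (k : ℝ), fun i j => by positivity, fun i => ?_, fun j => ?_⟩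
  · simp [div_eq_mul_inv]
  · simp [hk]

theorem isCompact_balancedMatrices (k n : ℕ) : IsCompact (balancedMatrices k n) := by
  have hsub : balancedMatrices k n ⊆
      Set.univ.pi fun _ : Fin k => Set.univ.pi fun _ : Fin n => Set.Icc (0 : ℝ) 1 := by
    rintro M ⟨h0, _, h1⟩ i - j -
    refine ⟨h0 i j, ?_⟩
    rw [← h1 j]
    exact Finset.single_le_sum (f := fun i => M i j) (fun i _ => h0 i j) (Finset.mem_univ i)
  refine IsCompact.of_isClosed_subset
    (isCompact_univ_pi fun _ => isCompact_univ_pi fun _ => isCompact_Icc) ?_ hsub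
  have he : ∀ i j, Continuous fun M : Matrix (Fin k) (Fin n) ℝ => M i j :=
    fun i j => continuous_id.matrix_elem i j
  have hset : balancedMatrices k n = (⋂ i, ⋂ j, {M | 0 ≤ M i j}) ∩
      ((⋂ i, {M | ∑ j, M i j = (n : ℝ) / k}) ∩ ⋂ j, {M | ∑ i, M i j = 1}) := by
    ext M
    simp [balancedMatrices]
  rw [hset]
  exact (isClosed_iInter fun i => isClosed_iInter fun j =>
      isClosed_le continuous_const (he i j)).inter
    ((isClosed_iInter fun i =>
      isClosed_eq (continuous_finsetSum _ fun j _ => he i j) continuous_const).inter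
    (isClosed_iInter fun j =>
      isClosed_eq (continuous_finsetSum _ fun i _ => he i j) continuous_const))

/-- The `k`-shape `C(S,k)` of an `n × n` matrix. -/
def matrixShape {n : ℕ} (S : Matrix (Fin n) (Fin n) ℝ) (k : ℕ) [NeZero k] :
    NonemptyCompacts (EllOneMat k) where
  carrier := matrixShapeSet S k
  isCompact' := by
    refine (isCompact_balancedMatrices k n).image ?_
    refine (PiLp.continuous_toLp 1 _).comp (continuous_pi fun q => ?_)
    exact ((continuous_id.matrix_mul continuous_const).matrix_mul
      continuous_id.matrix_transpose).matrix_elem q.1 q.2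
  nonempty' := (balancedMatrices_nonempty k n).image _

/-- The sum `γ(S)` of all entries of a matrix. -/
def entrySum {n : ℕ} (S : Matrix (Fin n) (Fin n) ℝ) : ℝ := ∑ a, ∑ b, S a b

/-- Symmetric matrices with nonnegative entries. -/
def IsSymmNonneg {n : ℕ} (S : Matrix (Fin n) (Fin n) ℝ) : Prop :=
  S.IsSymm ∧ ∀ a b, 0 ≤ S a b

/-- A sequence of square matrices (of possibly varying sizes) is shape convergent if for every
`k ≥ 1` the `k`-shapes converge to some compact set in the Hausdorff metric. -/
def ShapeConvergent {n : ℕ → ℕ} (S : ∀ i, Matrix (Fin (n i)) (Fin (n i)) ℝ) : Prop :=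
  ∀ (k : ℕ) [NeZero k], ∃ L : NonemptyCompacts (EllOneMat k),
    Tendsto (fun i => matrixShape (S i) k) atTop (𝓝 L)

/-- The measure `μ` is a limit of the matrix sequence `S`: for every `k ≥ 1` the `k`-shapes of the
matrices converge to `C(μ,k)` in the Hausdorff metric. -/
def ShapeTendsto {c : ℝ≥0} {n : ℕ → ℕ} (S : ∀ i, Matrix (Fin (n i)) (Fin (n i)) ℝ)
    (μ : SymMeasure c) : Prop :=
  ∀ (k : ℕ) [NeZero k], Tendsto (fun i => matrixShape (S i) k) atTop (𝓝 (shape μ.meas k))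

end ShapeSpace

end

/-!
The proof works with shapes over arbitrary base spaces: a probability measure `ν` on `Ω` fixes the
admissible fractional partitions, and a finite measure `μ` on `Ω × Ω` their quotient matrices
(`weightedShape`). The Cantor space is the case `(𝒞, ν)`, and an `n × n` matrix is the case of the
uniform measure on `Fin n`. Since `μ` may charge `ν`-null sets, functions have to be compared
uniformly, or in `L¹` of the marginals of `μ`, and never only `ν`-almost everywhere.

*Transfer.* Shapes shrink under Markov kernels (`weightedShape_comp_subset`), hence are preserved
by a kernel with a deterministic left inverse. Every standard Borel probability space `(X, ρ)` has
a kernel to the Cantor space that carries `ρ` to `ν` and has a left inverse at every point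
(`exists_kernel_leftInverse`): disintegrate `ν` along a map `T` with image `ρ`, and send the
`ρ`-null set of bad points injectively into a `ν`-null set. So measures over `(X, ρ)`, in
particular matrices, have the shapes of measures over the Cantor space.

*Limits.* Let the shapes of `μ_i` converge along an ultrafilter to compact sets `L_k`
(`exists_symMeasure_shape_eq`). Realise a countable dense part of all `L_k` approximately by
partitions for each `μ_i`, read these partitions as maps to a compact product `X` of simplices, and
take weak limits `ρ`, `m` of the images of `ν`, `μ_i`. The coordinates of `X` show that the shape
of `m` contains `L_k`. Conversely a partition of `X` is `L¹`-close to a continuous one, which pulls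
back to nearly balanced partitions for `μ_i`; correcting the weights costs little
(`IsPartitionOfUnity.exists_equal_weights`), so the shape of `m` lies in `L_k`. Transfer gives a
measure over the Cantor space. This yields compactness (the shapes of all the measures lie in a
fixed ball, so they converge along any ultrafilter) and limits of convergent matrix sequences.

*Approximation by matrices.* If `g` is a partition into `n` parts of weight `1 / n`, the shapes of
the matrix `∫ g_a(x) g_b(y) dμ` are contained in those of `μ`. For finitely many prescribed
partitions of `μ` there is such a `g` from which all of them can be merged up to a uniformly small
error (`exists_overlapMatrix_approx`), so these matrices fill up the shapes of `μ`.
-/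

noncomputable section

namespace ShapeSpace

/-! ### Shapes over an arbitrary measure space -/

section General

variable {Ω : Type*} [MeasurableSpace Ω]

/-- A family of `k` nonnegative measurable functions with sum `1`, with no condition on the
weights of the parts. -/
structure IsPartitionOfUnity (k : ℕ) (f : Fin k → Ω → ℝ) : Prop where
  measurable : ∀ i, Measurable (f i)
  nonneg : ∀ i x, 0 ≤ f i x
  sum_eq_one : ∀ x, ∑ i, f i x = 1

/-- The `k × k` matrix with entries `∫ f_i(x) f_j(y) dμ(x,y)`, for a measure on the square of any
measurable space. -/
def quotMat (μ : Measure (Ω × Ω)) {k : ℕ} (f : Fin k → Ω → ℝ) : EllOneMat k :=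
  WithLp.toLp 1 fun q => ∫ p, f q.1 p.1 * f q.2 p.2 ∂μ

/-- The set of quotient matrices of `μ` by the fractional partitions into `k` parts of equal
`ν`-weight. It depends on the base measure `ν` only through the admissible partitions. -/
def weightedShape (ν : Measure Ω) (μ : Measure (Ω × Ω)) (k : ℕ) : Set (EllOneMat k) :=
  {X | ∃ f : Fin k → Ω → ℝ, IsPartitionOfUnity k f ∧ (∀ i, ∫ x, f i x ∂ν = 1 / (k : ℝ)) ∧
    X = quotMat μ f}

theorem preShape_eq_weightedShape (μ : Measure (Cantor × Cantor)) (k : ℕ) :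
    preShape μ k = weightedShape cantorMeasure μ k := by
  ext X
  constructor
  · rintro ⟨f, hf, rfl⟩
    exact ⟨f, ⟨hf.measurable, hf.nonneg, hf.sum_eq_one⟩, hf.integral_eq, rfl⟩
  · rintro ⟨f, hf, hi, rfl⟩
    exact ⟨f, ⟨hf.measurable, hf.nonneg, hf.sum_eq_one, hi⟩, rfl⟩

theorem quotMat_apply (μ : Measure (Ω × Ω)) {k : ℕ} (f : Fin k → Ω → ℝ) (q : Fin k × Fin k) :
    quotMat μ f q = ∫ p, f q.1 p.1 * f q.2 p.2 ∂μ := rfl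

theorem dist_ellOneMat {k : ℕ} (X Y : EllOneMat k) : dist X Y = ∑ q, |X q - Y q| := by
  rw [dist_eq_norm, PiLp.norm_eq_of_L1]
  rfl

namespace IsPartitionOfUnity

variable {k : ℕ} {f g : Fin k → Ω → ℝ}

theorem le_one (hf : IsPartitionOfUnity k f) (i : Fin k) (x : Ω) : f i x ≤ 1 := by
  rw [← hf.sum_eq_one x]
  exact Finset.single_le_sum (f := fun i => f i x) (fun j _ => hf.nonneg j x) (Finset.mem_univ i)

theorem integrable (hf : IsPartitionOfUnity k f) (i : Fin k) (ν : Measure Ω) [IsFiniteMeasure ν] :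
    Integrable (f i) ν :=
  Integrable.of_bound (hf.measurable i).aestronglyMeasurable 1 (Eventually.of_forall fun x => by
    rw [Real.norm_eq_abs, abs_of_nonneg (hf.nonneg i x)]; exact hf.le_one i x)

theorem integrable_fst (hf : IsPartitionOfUnity k f) (i : Fin k) (μ : Measure (Ω × Ω))
    [IsFiniteMeasure μ] : Integrable (fun p : Ω × Ω => f i p.1) μ :=
  Integrable.of_bound ((hf.measurable i).comp measurable_fst).aestronglyMeasurable 1
    (Eventually.of_forall fun x => by
      rw [Real.norm_eq_abs, abs_of_nonneg (hf.nonneg i _)]; exact hf.le_one i _)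

theorem integrable_snd (hf : IsPartitionOfUnity k f) (i : Fin k) (μ : Measure (Ω × Ω))
    [IsFiniteMeasure μ] : Integrable (fun p : Ω × Ω => f i p.2) μ :=
  Integrable.of_bound ((hf.measurable i).comp measurable_snd).aestronglyMeasurable 1
    (Eventually.of_forall fun x => by
      rw [Real.norm_eq_abs, abs_of_nonneg (hf.nonneg i _)]; exact hf.le_one i _)

theorem integrable_mul (hf : IsPartitionOfUnity k f) (i j : Fin k) (μ : Measure (Ω × Ω))
    [IsFiniteMeasure μ] : Integrable (fun p : Ω × Ω => f i p.1 * f j p.2) μ :=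
  Integrable.of_bound (((hf.measurable i).comp measurable_fst).mul
    ((hf.measurable j).comp measurable_snd)).aestronglyMeasurable 1
    (Eventually.of_forall fun x => by
      rw [Real.norm_eq_abs, abs_of_nonneg (mul_nonneg (hf.nonneg i _) (hf.nonneg j _))]
      exact mul_le_one₀ (hf.le_one _ _) (hf.nonneg _ _) (hf.le_one _ _))

theorem comp {Ω' : Type*} [MeasurableSpace Ω'] {f : Fin k → Ω → ℝ} (hf : IsPartitionOfUnity k f)
    {T : Ω' → Ω} (hT : Measurable T) : IsPartitionOfUnity k fun i x => f i (T x) :=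
  ⟨fun i => (hf.measurable i).comp hT, fun i _ => hf.nonneg i _, fun _ => hf.sum_eq_one _⟩

theorem abs_quotMat_sub_le (hf : IsPartitionOfUnity k f) (hg : IsPartitionOfUnity k g)
    (μ : Measure (Ω × Ω)) [IsFiniteMeasure μ] (q : Fin k × Fin k) :
    |quotMat μ f q - quotMat μ g q| ≤
      ∫ p, |f q.1 p.1 - g q.1 p.1| ∂μ + ∫ p, |f q.2 p.2 - g q.2 p.2| ∂μ := by
  rw [quotMat_apply, quotMat_apply,
    ← integral_sub (hf.integrable_mul _ _ μ) (hg.integrable_mul _ _ μ)]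
  have h1 := ((hf.integrable_fst q.1 μ).sub (hg.integrable_fst q.1 μ)).abs
  have h2 := ((hf.integrable_snd q.2 μ).sub (hg.integrable_snd q.2 μ)).abs
  simp only [Pi.sub_apply] at h1 h2
  refine (abs_integral_le_integral_abs).trans ?_
  rw [← integral_add h1 h2]
  refine integral_mono ((hf.integrable_mul _ _ μ).sub (hg.integrable_mul _ _ μ)).abs
    (h1.add h2) fun p => ?_
  have e : f q.1 p.1 * f q.2 p.2 - g q.1 p.1 * g q.2 p.2 =
    (f q.1 p.1 - g q.1 p.1) * f q.2 p.2 + g q.1 p.1 * (f q.2 p.2 - g q.2 p.2) := by ring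
  simp only [e]
  refine (abs_add_le _ _).trans ?_
  rw [abs_mul, abs_mul, abs_of_nonneg (hf.nonneg q.2 p.2), abs_of_nonneg (hg.nonneg q.1 p.1)]
  exact add_le_add (mul_le_of_le_one_right (abs_nonneg _) (hf.le_one _ _))
    (mul_le_of_le_one_left (abs_nonneg _) (hg.le_one _ _))

/-- Quotient matrices depend on the partition in a Lipschitz way, for the uniform distance of
functions. The uniform distance is needed because `μ` may be singular to the base measure. -/
theorem dist_quotMat_le (hf : IsPartitionOfUnity k f) (hg : IsPartitionOfUnity k g)
    (μ : Measure (Ω × Ω)) [IsFiniteMeasure μ] {e : ℝ} (h : ∀ i x, |f i x - g i x| ≤ e) :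
    dist (quotMat μ f) (quotMat μ g) ≤ (k * k : ℝ) * (2 * e * μ.real Set.univ) := by
  rw [dist_ellOneMat]
  refine (Finset.sum_le_card_nsmul _ _ (2 * e * μ.real Set.univ) fun q _ => ?_).trans (by simp)
  refine (hf.abs_quotMat_sub_le hg μ q).trans ?_
  have h1 : ∫ p, |f q.1 p.1 - g q.1 p.1| ∂μ ≤ ∫ _p, e ∂μ :=
    integral_mono ((hf.integrable_fst q.1 μ).sub (hg.integrable_fst q.1 μ)).abs
      (integrable_const _) fun p => h _ _
  have h2 : ∫ p, |f q.2 p.2 - g q.2 p.2| ∂μ ≤ ∫ _p, e ∂μ :=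
    integral_mono ((hf.integrable_snd q.2 μ).sub (hg.integrable_snd q.2 μ)).abs
      (integrable_const _) fun p => h _ _
  simp only [integral_const, smul_eq_mul] at h1 h2
  linarith

/-- A partition of unity whose weights are within `η` of `1 / k` can be corrected to one with
equal weights, by mixing in a small constant vector. The correction is uniformly small. -/
theorem exists_equal_weights [NeZero k] (hf : IsPartitionOfUnity k f) (ν : Measure Ω)
    [IsProbabilityMeasure ν] {η : ℝ} (hη : 0 < η) (h : ∀ i, |∫ x, f i x ∂ν - 1 / (k : ℝ)| ≤ η) :
    ∃ g, IsPartitionOfUnity k g ∧ (∀ i, ∫ x, g i x ∂ν = 1 / (k : ℝ)) ∧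
      ∀ i x, |g i x - f i x| ≤ k * η := by
  have hk : (0 : ℝ) < k := by exact_mod_cast NeZero.pos k
  -- `t` is the smallest mixing weight for which the compensating vector `q` is nonnegative
  set t : ℝ := k * η / (1 + k * η) with ht
  have hden : (0 : ℝ) < 1 + k * η := by positivity
  have ht0 : 0 < t := by positivity
  have ht1 : 1 - t = 1 / (1 + k * η) := by rw [ht]; field_simp; ring
  have ht2 : 0 ≤ 1 - t := by rw [ht1]; positivity
  set q : Fin k → ℝ := fun i => (1 / (k : ℝ) - (1 - t) * ∫ x, f i x ∂ν) / t with hq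
  have hq0 : ∀ i, 0 ≤ q i := by
    intro i
    refine div_nonneg ?_ ht0.le
    have h1 : ∫ x, f i x ∂ν ≤ 1 / (k : ℝ) + η := by linarith [(abs_le.1 (h i)).2]
    have h2 : (1 - t) * (1 / (k : ℝ) + η) = 1 / k := by rw [ht1]; field_simp
    linarith [mul_le_mul_of_nonneg_left h1 ht2]
  have hsum : ∑ i, ∫ x, f i x ∂ν = 1 := by
    rw [← integral_finsetSum _ fun i _ => hf.integrable i ν]
    simp [hf.sum_eq_one]
  have hqs : ∑ i, q i = 1 := by
    rw [hq, ← Finset.sum_div, Finset.sum_sub_distrib, ← Finset.mul_sum, hsum]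
    simp only [Finset.sum_const, Finset.card_univ, Fintype.card_fin, nsmul_eq_mul]
    field_simp
    ring
  have hq1 : ∀ i, q i ≤ 1 := fun i => by
    rw [← hqs]; exact Finset.single_le_sum (f := q) (fun j _ => hq0 j) (Finset.mem_univ i)
  refine ⟨fun i x => (1 - t) * f i x + t * q i, ⟨fun i => ?_, fun i x => ?_, fun x => ?_⟩,
    fun i => ?_, fun i x => ?_⟩
  · exact ((hf.measurable i).const_mul _).add_const _
  · have := hf.nonneg i x
    have := hq0 i
    positivity
  · rw [Finset.sum_add_distrib, ← Finset.mul_sum, ← Finset.mul_sum, hf.sum_eq_one, hqs]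
    ring
  · rw [integral_add ((hf.integrable i ν).const_mul _) (integrable_const _), integral_const_mul]
    simp only [integral_const, probReal_univ, one_smul, hq]
    field_simp
    ring
  · have e : (1 - t) * f i x + t * q i - f i x = t * (q i - f i x) := by ring
    have h3 : |q i - f i x| ≤ 1 := by
      rw [abs_le]
      constructor <;> linarith [hq0 i, hq1 i, hf.nonneg i x, hf.le_one i x]
    rw [e, abs_mul, abs_of_pos ht0]
    have h4 : t ≤ k * η := by
      rw [ht]
      exact div_le_self (by positivity) (by nlinarith)
    nlinarith [abs_nonneg (q i - f i x)]

/-- A partition of unity with nearly equal weights has a quotient matrix near the shape. -/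
theorem exists_mem_weightedShape_dist_le [NeZero k] (hf : IsPartitionOfUnity k f) (ν : Measure Ω)
    [IsProbabilityMeasure ν] (μ : Measure (Ω × Ω)) [IsFiniteMeasure μ] {η : ℝ} (hη : 0 < η)
    (h : ∀ i, |∫ x, f i x ∂ν - 1 / (k : ℝ)| ≤ η) :
    ∃ X ∈ weightedShape ν μ k,
      dist X (quotMat μ f) ≤ (k * k : ℝ) * (2 * (k * η) * μ.real Set.univ) := by
  obtain ⟨g, hg, hgi, hgf⟩ := hf.exists_equal_weights ν hη h
  exact ⟨_, ⟨g, hg, hgi, rfl⟩, hg.dist_quotMat_le hf μ hgf⟩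

theorem norm_quotMat (hf : IsPartitionOfUnity k f) (μ : Measure (Ω × Ω)) [IsFiniteMeasure μ] :
    ‖quotMat μ f‖ = μ.real Set.univ := by
  rw [PiLp.norm_eq_of_L1]
  have h0 : ∀ q : Fin k × Fin k, ‖quotMat μ f q‖ = ∫ p, f q.1 p.1 * f q.2 p.2 ∂μ := fun q => by
    rw [quotMat_apply, Real.norm_eq_abs, abs_of_nonneg]
    exact integral_nonneg fun p => mul_nonneg (hf.nonneg _ _) (hf.nonneg _ _)
  simp_rw [h0]
  rw [← integral_finsetSum _ fun q _ => hf.integrable_mul _ _ μ]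
  have : ∀ p : Ω × Ω, ∑ q : Fin k × Fin k, f q.1 p.1 * f q.2 p.2 = 1 := fun p => by
    rw [Fintype.sum_prod_type]
    simp_rw [← Finset.mul_sum, hf.sum_eq_one, mul_one]
    exact hf.sum_eq_one _
  simp [this]

end IsPartitionOfUnity

theorem norm_le_of_mem_closure_weightedShape {ν : Measure Ω} {μ : Measure (Ω × Ω)}
    [IsFiniteMeasure μ] {k : ℕ} {X : EllOneMat k} (hX : X ∈ closure (weightedShape ν μ k)) :
    ‖X‖ ≤ μ.real Set.univ := by
  refine closure_minimal (s := weightedShape ν μ k) (t := {X | ‖X‖ ≤ μ.real Set.univ}) ?_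
    (isClosed_le continuous_norm continuous_const) hX
  rintro _ ⟨f, hf, -, rfl⟩
  exact (hf.norm_quotMat μ).le

end General

/-! ### Shapes under Markov kernels -/

section Kernels

open ProbabilityTheory

variable {Ω Ω' : Type*} [MeasurableSpace Ω] [MeasurableSpace Ω']

theorem integral_kernel_comp_measure {E : Type*} [NormedAddCommGroup E] [NormedSpace ℝ E]
    (κ : Kernel Ω Ω') (ν : Measure Ω) {f : Ω' → E} (hf : Integrable f (κ ∘ₘ ν)) :
    ∫ y, f y ∂(κ ∘ₘ ν) = ∫ x, ∫ y, f y ∂κ x ∂ν := by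
  rw [Measure.comp_eq_comp_const_apply] at hf ⊢
  rw [Kernel.integral_comp hf, Kernel.const_apply]

/-- Averaging along a Markov kernel turns partitions of the target into partitions of the source
with the same weights and the same quotient matrix, so shapes shrink under Markov kernels. -/
theorem weightedShape_comp_subset (κ : Kernel Ω Ω') [IsMarkovKernel κ] (ν : Measure Ω)
    [IsFiniteMeasure ν] (μ : Measure (Ω × Ω)) [IsFiniteMeasure μ] (k : ℕ) :
    weightedShape (κ ∘ₘ ν) ((κ ∥ₖ κ) ∘ₘ μ) k ⊆ weightedShape ν μ k := by
  rintro _ ⟨f, hf, hfi, rfl⟩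
  refine ⟨fun i x => ∫ y, f i y ∂κ x, ⟨fun i => ?_, fun i x => ?_, fun x => ?_⟩, fun i => ?_, ?_⟩
  · exact ((hf.measurable i).stronglyMeasurable.integral_kernel).measurable
  · exact integral_nonneg fun y => hf.nonneg i y
  · rw [← integral_finsetSum _ fun i _ => hf.integrable i _]
    simp [hf.sum_eq_one]
  · rw [← hfi i, integral_kernel_comp_measure κ ν (hf.integrable i _)]
  · ext q
    rw [quotMat_apply, quotMat_apply, integral_kernel_comp_measure _ _ (hf.integrable_mul _ _ _)]
    refine integral_congr_ae (Eventually.of_forall fun p => ?_)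
    simp only [Kernel.parallelComp_apply]
    exact integral_prod_mul (f q.1) (f q.2)

theorem weightedShape_map_subset {T : Ω → Ω'} (hT : Measurable T) (ν : Measure Ω)
    (μ : Measure (Ω × Ω)) [IsFiniteMeasure μ] (k : ℕ) :
    weightedShape (ν.map T) (μ.map (Prod.map T T)) k ⊆ weightedShape ν μ k := by
  rintro _ ⟨f, hf, hfi, rfl⟩
  refine ⟨fun i x => f i (T x), hf.comp hT, fun i => ?_, ?_⟩
  · rw [← hfi i, integral_map hT.aemeasurable (hf.measurable i).aestronglyMeasurable]
  · ext q
    rw [quotMat_apply, quotMat_apply, integral_map (hT.prodMap hT).aemeasurable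
      (hf.integrable_mul _ _ _).aestronglyMeasurable]
    rfl

theorem parallelComp_map_eq_id {κ : Kernel Ω Ω'} [IsMarkovKernel κ] {T : Ω' → Ω}
    (hT : Measurable T) (h : κ.map T = Kernel.id) :
    (κ ∥ₖ κ).map (Prod.map T T) = Kernel.id := by
  have h' : ∀ x, (κ x).map T = Measure.dirac x := fun x => by
    rw [← Kernel.map_apply _ hT, h, Kernel.id_apply]
  ext p : 1
  rw [Kernel.map_apply _ (hT.prodMap hT), Kernel.parallelComp_apply,
    ← Measure.map_prod_map _ _ hT hT, h', h', Measure.dirac_prod_dirac, Kernel.id_apply]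

/-- A Markov kernel with a deterministic left inverse `T` preserves shapes. The inverse relation
has to hold at every point, not only almost everywhere, as `μ` may charge `ν`-null sets. -/
theorem weightedShape_comp_eq {κ : Kernel Ω Ω'} [IsMarkovKernel κ] {T : Ω' → Ω}
    (hT : Measurable T) (h : κ.map T = Kernel.id) (ν : Measure Ω)
    [IsFiniteMeasure ν] (μ : Measure (Ω × Ω)) [IsFiniteMeasure μ] (k : ℕ) :
    weightedShape (κ ∘ₘ ν) ((κ ∥ₖ κ) ∘ₘ μ) k = weightedShape ν μ k := by
  refine (weightedShape_comp_subset κ ν μ k).antisymm ?_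
  have h1 := weightedShape_map_subset hT (κ ∘ₘ ν) ((κ ∥ₖ κ) ∘ₘ μ) k
  rwa [Measure.map_comp _ _ hT, Measure.map_comp _ _ (hT.prodMap hT), h,
    parallelComp_map_eq_id hT h, Measure.id_comp, Measure.id_comp] at h1

theorem map_swap_parallelComp_comp (κ : Kernel Ω Ω') [IsMarkovKernel κ] (μ : Measure (Ω × Ω))
    (hμ : μ.map Prod.swap = μ) : ((κ ∥ₖ κ) ∘ₘ μ).map Prod.swap = (κ ∥ₖ κ) ∘ₘ μ := by
  conv_rhs => rw [← hμ]
  rw [Measure.map_comp _ _ measurable_swap, ← Kernel.swap_comp_eq_map, Kernel.swap_parallelComp,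
    ← Measure.comp_assoc, Measure.swap_comp]

theorem comp_measure_univ (κ : Kernel Ω Ω') [IsMarkovKernel κ] (ν : Measure Ω) :
    (κ ∘ₘ ν) Set.univ = ν Set.univ := by
  rw [Measure.bind_apply MeasurableSet.univ κ.aemeasurable]
  simp

end Kernels

/-! ### The Cantor measure as a universal source of randomness -/

section Uniform

open ProbabilityTheory

theorem cantorMeasure_cylinder (s : Finset ℕ) (c : ℕ → Bool) :
    cantorMeasure {x | ∀ i ∈ s, x i = c i} = 2⁻¹ ^ s.card := by
  have h : {x : Cantor | ∀ i ∈ s, x i = c i} = Set.pi s fun i => {c i} := by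
    ext x; simp [Set.mem_pi]
  rw [h, cantorMeasure, Measure.infinitePi_pi _ fun i _ => measurableSet_singleton _]
  simp

/-- The integer whose binary digits are the first `n` bits of `x`. -/
def leadingBits : ℕ → Cantor → ℕ
  | 0, _ => 0
  | n + 1, x => 2 * leadingBits n x + (x n).toNat

theorem leadingBits_lt (n : ℕ) (x : Cantor) : leadingBits n x < 2 ^ n := by
  induction n with
  | zero => simp [leadingBits]
  | succ n ih =>
    have : (x n).toNat ≤ 1 := Bool.toNat_le _
    rw [leadingBits, pow_succ]
    omega

theorem measurable_leadingBits (n : ℕ) : Measurable (leadingBits n) := by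
  induction n with
  | zero => exact measurable_const
  | succ n ih =>
    have h : Measurable fun x : Cantor => (x n).toNat :=
      (measurable_of_countable Bool.toNat).comp (measurable_pi_apply n)
    exact (ih.const_mul 2).add h

theorem exists_leadingBits_eq_iff (n : ℕ) : ∀ j < 2 ^ n,
    ∃ c : ℕ → Bool, ∀ x, leadingBits n x = j ↔ ∀ i ∈ Finset.range n, x i = c i := by
  induction n with
  | zero => intro j hj; exact ⟨fun _ => false, fun x => by simp [leadingBits]; omega⟩
  | succ n ih =>
    intro j hj
    obtain ⟨c, hc⟩ := ih (j / 2) (by rw [pow_succ] at hj; omega)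
    refine ⟨fun i => if i = n then decide (j % 2 = 1) else c i, fun x => ?_⟩
    have hb : (x n).toNat = j % 2 ↔ x n = decide (j % 2 = 1) := by
      rcases Nat.mod_two_eq_zero_or_one j with h | h <;> cases x n <;> simp [h]
    have h1 : leadingBits (n + 1) x = j ↔ leadingBits n x = j / 2 ∧ (x n).toNat = j % 2 := by
      have : (x n).toNat ≤ 1 := Bool.toNat_le _
      rw [leadingBits]
      omega
    rw [h1, hc, hb, Finset.range_add_one]
    simp only [Finset.mem_insert, forall_eq_or_imp, if_true, Finset.mem_range]
    rw [and_comm]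
    refine and_congr_right fun _ => forall₂_congr fun i hi => ?_
    rw [if_neg hi.ne]

theorem cantorMeasure_leadingBits_lt (n j : ℕ) (hj : j ≤ 2 ^ n) :
    cantorMeasure {x | leadingBits n x < j} = j * 2⁻¹ ^ n := by
  induction j with
  | zero => simp
  | succ j ih =>
    obtain ⟨c, hc⟩ := exists_leadingBits_eq_iff n j hj
    have hm : MeasurableSet {x | leadingBits n x = j} :=
      measurable_leadingBits n (measurableSet_singleton j)
    have h1 : {x | leadingBits n x < j + 1} =
        {x | leadingBits n x < j} ∪ {x | leadingBits n x = j} := by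
      ext x; simp only [Set.mem_ofPred_eq, Set.mem_union]; omega
    have h2 : {x | leadingBits n x = j} = {x | ∀ i ∈ Finset.range n, x i = c i} := by
      ext x; exact hc x
    rw [h1, measure_union (Set.disjoint_left.2 fun x hx hx' => by
      simp only [Set.mem_ofPred_eq] at hx hx'; omega) hm, ih (by omega), h2,
      cantorMeasure_cylinder, Finset.card_range]
    push_cast
    ring

/-- The real number `∑ x_n 2^{-(n+1)}` with binary digits `x`, as a supremum of truncations. -/
def binaryValue (x : Cantor) : ℝ := ⨆ n, (leadingBits n x : ℝ) / 2 ^ n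

theorem bddAbove_leadingBits (x : Cantor) :
    BddAbove (Set.range fun n => (leadingBits n x : ℝ) / 2 ^ n) := by
  refine ⟨1, ?_⟩
  rintro _ ⟨n, rfl⟩
  rw [div_le_one (by positivity)]
  exact_mod_cast (leadingBits_lt n x).le

theorem le_binaryValue (n : ℕ) (x : Cantor) : (leadingBits n x : ℝ) / 2 ^ n ≤ binaryValue x :=
  le_ciSup (bddAbove_leadingBits x) n

theorem binaryValue_le (n : ℕ) (x : Cantor) :
    binaryValue x ≤ ((leadingBits n x : ℝ) + 1) / 2 ^ n := by
  have hb : ∀ m, ((x m).toNat : ℝ) ≤ 1 := fun m => by exact_mod_cast Bool.toNat_le _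
  -- the truncations increase, while the truncations rounded up decrease
  have mono : Monotone fun n => (leadingBits n x : ℝ) / 2 ^ n := by
    refine monotone_nat_of_le_succ fun m => ?_
    rw [div_le_div_iff₀ (by positivity) (by positivity), leadingBits, pow_succ]
    push_cast
    have : (0 : ℝ) < 2 ^ m := by positivity
    nlinarith [(Nat.cast_nonneg (x m).toNat : (0 : ℝ) ≤ _)]
  have anti : Antitone fun n => ((leadingBits n x : ℝ) + 1) / 2 ^ n := by
    refine antitone_nat_of_succ_le fun m => ?_
    rw [div_le_div_iff₀ (by positivity) (by positivity), leadingBits, pow_succ]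
    push_cast
    have : (0 : ℝ) < 2 ^ m := by positivity
    nlinarith [hb m]
  refine ciSup_le fun m => ?_
  rcases le_total m n with h | h
  · refine (mono h).trans ?_
    simp only
    gcongr
    simp
  · refine le_trans ?_ (anti h)
    simp only
    gcongr
    simp

theorem measurable_binaryValue : Measurable binaryValue := by
  refine Measurable.iSup fun n => ?_
  exact ((measurable_of_countable fun m : ℕ => (m : ℝ)).comp
    (measurable_leadingBits n)).div_const _

theorem binaryValue_mem (x : Cantor) : binaryValue x ∈ unitInterval := by
  refine ⟨?_, ?_⟩
  · simpa [leadingBits] using le_binaryValue 0 x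
  · simpa [leadingBits] using binaryValue_le 0 x

/-- The distribution function of `binaryValue` is squeezed between its values at neighbouring
dyadic rationals. -/
theorem cantorMeasure_binaryValue_le {t : ℝ} (h0 : 0 ≤ t) (h1 : t ≤ 1) :
    cantorMeasure.real {x | binaryValue x ≤ t} = t := by
  have key : ∀ n j : ℕ, j ≤ 2 ^ n →
      cantorMeasure.real {x | leadingBits n x < j} = (j : ℝ) / 2 ^ n := by
    intro n j hj
    rw [measureReal_def, cantorMeasure_leadingBits_lt n j hj]
    simp [div_eq_mul_inv]
  have hlow : ∀ n : ℕ, t - 1 / 2 ^ n ≤ cantorMeasure.real {x | binaryValue x ≤ t} := by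
    intro n
    have hp : (0 : ℝ) < 2 ^ n := by positivity
    have hj : ⌊t * 2 ^ n⌋₊ ≤ 2 ^ n := by
      have : ⌊t * 2 ^ n⌋₊ ≤ ⌊(2 : ℝ) ^ n⌋₊ := Nat.floor_mono (by nlinarith)
      refine this.trans (le_of_eq ?_)
      exact_mod_cast Nat.floor_natCast (R := ℝ) (2 ^ n)
    have hfl : (⌊t * 2 ^ n⌋₊ : ℝ) ≤ t * 2 ^ n := Nat.floor_le (by positivity)
    have hfl' : t * 2 ^ n < (⌊t * 2 ^ n⌋₊ : ℝ) + 1 := Nat.lt_floor_add_one _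
    refine le_trans ?_ (measureReal_mono (s₁ := {x | leadingBits n x < ⌊t * 2 ^ n⌋₊}) ?_)
    · rw [key n _ hj, le_div_iff₀ hp, sub_mul, div_mul_cancel₀ _ hp.ne']
      linarith
    · intro x hx
      simp only [Set.mem_ofPred_eq] at hx ⊢
      refine (binaryValue_le n x).trans ?_
      rw [div_le_iff₀ hp]
      have : (leadingBits n x : ℝ) + 1 ≤ ⌊t * 2 ^ n⌋₊ := by exact_mod_cast hx
      linarith
  have hup : ∀ n : ℕ, cantorMeasure.real {x | binaryValue x ≤ t} ≤ t + 1 / 2 ^ n := by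
    intro n
    have hp : (0 : ℝ) < 2 ^ n := by positivity
    have hfl : (⌊t * 2 ^ n⌋₊ : ℝ) ≤ t * 2 ^ n := Nat.floor_le (by positivity)
    by_cases hj : ⌊t * 2 ^ n⌋₊ + 1 ≤ 2 ^ n
    · refine (measureReal_mono (s₂ := {x | leadingBits n x < ⌊t * 2 ^ n⌋₊ + 1}) ?_).trans ?_
      · intro x hx
        simp only [Set.mem_ofPred_eq] at hx ⊢
        rw [Nat.lt_add_one_iff]
        refine Nat.le_floor ?_
        rw [← div_le_iff₀ hp]
        exact (le_binaryValue n x).trans hx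
      · rw [key n _ hj, div_le_iff₀ hp, add_mul, div_mul_cancel₀ _ hp.ne']
        push_cast
        linarith
    · refine measureReal_le_one.trans ?_
      have h2 : (2 : ℝ) ^ n < (⌊t * 2 ^ n⌋₊ : ℝ) + 1 := by exact_mod_cast not_le.1 hj
      have : 1 ≤ (t * 2 ^ n + 1) / 2 ^ n := by rw [le_div_iff₀ hp]; linarith
      rwa [add_div, mul_div_cancel_right₀ _ hp.ne'] at this
  have hlim : Tendsto (fun n : ℕ => 1 / (2 : ℝ) ^ n) atTop (𝓝 0) := by
    simpa using tendsto_pow_atTop_nhds_zero_of_lt_one (r := (1 / 2 : ℝ)) (by norm_num) (by norm_num)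
  refine le_antisymm ?_ ?_
  · refine ge_of_tendsto' (x := atTop) (f := fun n : ℕ => t + 1 / (2 : ℝ) ^ n) ?_ hup
    simpa using hlim.const_add t
  · refine le_of_tendsto' (x := atTop) (f := fun n : ℕ => t - 1 / (2 : ℝ) ^ n) ?_ hlow
    simpa using hlim.const_sub t

/-- The binary digits of a uniform point of the unit interval are independent fair coins. -/
theorem cantorMeasure_map_binaryValue :
    cantorMeasure.map (fun x => (⟨binaryValue x, binaryValue_mem x⟩ : unitInterval)) = volume := by
  have hm : Measurable fun x => (⟨binaryValue x, binaryValue_mem x⟩ : unitInterval) :=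
    measurable_binaryValue.subtype_mk
  have : IsProbabilityMeasure (cantorMeasure.map
      fun x => (⟨binaryValue x, binaryValue_mem x⟩ : unitInterval)) :=
    Measure.isProbabilityMeasure_map hm.aemeasurable
  refine Measure.ext_of_Iic _ _ fun t => ?_
  rw [Measure.map_apply hm measurableSet_Iic, unitInterval.volume_Iic,
    ← cantorMeasure_binaryValue_le t.2.1 t.2.2, ofReal_measureReal]
  rfl

/-- Every probability measure on a standard Borel space is an image of the Cantor measure. -/
theorem exists_measurable_cantorMeasure_map_eq {X : Type*} [MeasurableSpace X]
    [StandardBorelSpace X] [Nonempty X] (ρ : Measure X) [IsProbabilityMeasure ρ] :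
    ∃ T : Cantor → X, Measurable T ∧ cantorMeasure.map T = ρ := by
  obtain ⟨f, hf, hfρ⟩ := ρ.exists_measurable_map_eq
  refine ⟨fun x => f ⟨binaryValue x, binaryValue_mem x⟩,
    hf.comp measurable_binaryValue.subtype_mk, ?_⟩
  rw [← hfρ, ← cantorMeasure_map_binaryValue,
    Measure.map_map hf measurable_binaryValue.subtype_mk]
  rfl

/-- The bit sequences vanishing at all even places: a null set that is still large enough to
contain a copy of every standard Borel space. -/
def evenZeros : Set Cantor := {x | ∀ n, x (2 * n) = false}

theorem measurableSet_evenZeros : MeasurableSet evenZeros := by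
  rw [evenZeros, Set.ofPred_forall]
  exact MeasurableSet.iInter fun n =>
    measurableSet_eq_fun (measurable_pi_apply (2 * n)) measurable_const

theorem cantorMeasure_evenZeros : cantorMeasure evenZeros = 0 := by
  have hle : ∀ n : ℕ, cantorMeasure evenZeros ≤ 2⁻¹ ^ n := by
    intro n
    have h := cantorMeasure_cylinder ((Finset.range n).image (2 * ·)) fun _ => false
    rw [Finset.card_image_of_injective _ fun a b h => by simpa using h, Finset.card_range] at h
    rw [← h]
    refine measure_mono fun x hx i hi => ?_
    obtain ⟨m, -, rfl⟩ := Finset.mem_image.1 hi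
    exact hx m
  refine le_antisymm (ge_of_tendsto' (x := atTop) ?_ hle) bot_le
  exact ENNReal.tendsto_pow_atTop_nhds_zero_of_lt_one (by simp)

theorem exists_measurableEmbedding_evenZeros (X : Type*) [MeasurableSpace X]
    [StandardBorelSpace X] : ∃ s : X → Cantor, MeasurableEmbedding s ∧ ∀ x, s x ∈ evenZeros := by
  refine ⟨fun x n => if n % 2 = 0 then false else MeasurableSpace.mapNatBool X x (n / 2),
    Measurable.measurableEmbedding ?_ ?_, fun x n => by simp⟩
  · refine measurable_pi_lambda _ fun n => ?_
    by_cases h : n % 2 = 0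
    · simp [h]
    · simp only [h, if_false]
      exact (measurable_pi_apply _).comp (MeasurableSpace.measurable_mapNatBool X)
  · intro x y hxy
    refine MeasurableSpace.injective_mapNatBool X (funext fun n => ?_)
    have h := congrFun hxy (2 * n + 1)
    have h2 : (2 * n + 1) % 2 = 1 := by omega
    have h3 : (2 * n + 1) / 2 = n := by omega
    simpa [h2, h3] using h

/-- Every standard Borel probability space `(X, ρ)` is a quotient of the Cantor space by a map `T`
whose disintegration `κ` is supported on the fibre of `T` over every point, not only over
almost every one: the exceptional points are moved into a null set of the Cantor space. -/
theorem exists_kernel_leftInverse {X : Type*} [MeasurableSpace X] [StandardBorelSpace X]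
    [Nonempty X] (ρ : Measure X) [IsProbabilityMeasure ρ] :
    ∃ (κ : Kernel X Cantor) (T : Cantor → X), IsMarkovKernel κ ∧ Measurable T ∧
      κ.map T = Kernel.id ∧ κ ∘ₘ ρ = cantorMeasure := by
  classical
  obtain ⟨T₀, hT₀, hρ⟩ := exists_measurable_cantorMeasure_map_eq ρ
  obtain ⟨s, hs, hsZ⟩ := exists_measurableEmbedding_evenZeros X
  set κ₀ : Kernel X Cantor := condDistrib id T₀ cantorMeasure with hκ₀
  have hcomp : κ₀ ∘ₘ ρ = cantorMeasure := by
    rw [← hρ, hκ₀, condDistrib_comp_map hT₀.aemeasurable aemeasurable_id, Measure.map_id]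
  have hfib : ∀ᵐ x ∂ρ, (κ₀ x).map T₀ = Measure.dirac x := by
    have h1 := condDistrib_comp (μ := cantorMeasure) (mβ := inferInstance) T₀ aemeasurable_id hT₀
    have h2 := condDistrib_self (μ := cantorMeasure) T₀
    rw [hρ] at h1 h2
    filter_upwards [h1, h2] with x hx1 hx2
    rw [← Kernel.map_apply _ hT₀, ← hx1, Function.comp_id, hx2, Kernel.id_apply]
  have hZ : ∀ᵐ x ∂ρ, κ₀ x evenZeros = 0 := by
    have h1 : (κ₀ ∘ₘ ρ) evenZeros = 0 := by rw [hcomp, cantorMeasure_evenZeros]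
    rw [Measure.bind_apply measurableSet_evenZeros κ₀.aemeasurable,
      lintegral_eq_zero_iff (κ₀.measurable_coe measurableSet_evenZeros)] at h1
    exact h1
  obtain ⟨N, hbad, hN, hN0⟩ := exists_measurable_superset_of_null (ae_iff.1 (hfib.and hZ))
  set T : Cantor → X := fun x => if x ∈ evenZeros then hs.invFun x else T₀ x with hTdef
  have hT : Measurable T := Measurable.ite measurableSet_evenZeros hs.measurable_invFun hT₀
  refine ⟨Kernel.piecewise hN (Kernel.deterministic s hs.measurable) κ₀, T, inferInstance, hT,
    ?_, ?_⟩
  · ext x : 1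
    rw [Kernel.map_apply _ hT, Kernel.id_apply, Kernel.piecewise_apply]
    split_ifs with hx
    · rw [Kernel.deterministic_apply, Measure.map_dirac' hT]
      simp [hTdef, hsZ x, hs.leftInverse_invFun x]
    · have hx' : (κ₀ x).map T₀ = Measure.dirac x ∧ κ₀ x evenZeros = 0 := by
        by_contra hcon
        exact hx (hbad hcon)
      rw [← hx'.1]
      refine Measure.map_congr ?_
      have : ∀ᵐ y ∂κ₀ x, y ∉ evenZeros := measure_eq_zero_iff_ae_notMem.1 hx'.2
      filter_upwards [this] with y hy
      simp [hTdef, hy]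
  · rw [← hcomp]
    refine Measure.comp_congr ?_
    have : ∀ᵐ x ∂ρ, x ∉ N := measure_eq_zero_iff_ae_notMem.1 hN0
    filter_upwards [this] with x hx
    rw [Kernel.piecewise_apply, if_neg hx]

/-- A symmetric measure over any standard Borel probability space has the same shapes as some
symmetric measure of the same mass over the Cantor space. -/
theorem exists_symMeasure_weightedShape_eq {c : ℝ≥0} {X : Type*} [MeasurableSpace X]
    [StandardBorelSpace X] [Nonempty X] (ρ : Measure X) [IsProbabilityMeasure ρ]
    (m : Measure (X × X)) (hsymm : m.map Prod.swap = m) (hc : m Set.univ ≤ (c : ℝ≥0∞)) :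
    ∃ μ : SymMeasure c, ∀ k, preShape μ.meas k = weightedShape ρ m k := by
  have : IsFiniteMeasure m := ⟨hc.trans_lt ENNReal.coe_lt_top⟩
  obtain ⟨κ, T, hκ, hT, hid, hρ⟩ := exists_kernel_leftInverse ρ
  refine ⟨⟨(κ ∥ₖ κ) ∘ₘ m, map_swap_parallelComp_comp κ m hsymm, ?_⟩, fun k => ?_⟩
  · rwa [comp_measure_univ]
  · rw [preShape_eq_weightedShape, ← hρ]
    exact weightedShape_comp_eq hT hid ρ m k

end Uniform

/-! ### Shapes and weak limits of measures -/

section WeakLimits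

theorem integral_le_integral_add_marginals {X : Type*} [MeasurableSpace X] {ρ : Measure X}
    {m : Measure (X × X)} [IsFiniteMeasure ρ] [IsFiniteMeasure m] {u : X → ℝ} (hu : Measurable u)
    (hu0 : ∀ x, 0 ≤ u x)
    (hi : Integrable u (ρ + (m.fst + m.snd))) :
    ∫ x, u x ∂ρ ≤ ∫ x, u x ∂(ρ + (m.fst + m.snd)) ∧
    ∫ p, u p.1 ∂m ≤ ∫ x, u x ∂(ρ + (m.fst + m.snd)) ∧
    ∫ p, u p.2 ∂m ≤ ∫ x, u x ∂(ρ + (m.fst + m.snd)) := by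
  have h0 : 0 ≤ᵐ[ρ + (m.fst + m.snd)] u := Eventually.of_forall hu0
  refine ⟨integral_mono_measure (Measure.le_add_right le_rfl) h0 hi, ?_, ?_⟩
  · have : ∫ p, u p.1 ∂m = ∫ x, u x ∂m.fst := by
      rw [Measure.fst, integral_map measurable_fst.aemeasurable hu.aestronglyMeasurable]
    rw [this]
    exact integral_mono_measure (Measure.le_add_left (Measure.le_add_right le_rfl)) h0 hi
  · have : ∫ p, u p.2 ∂m = ∫ x, u x ∂m.snd := by
      rw [Measure.snd, integral_map measurable_snd.aemeasurable hu.aestronglyMeasurable]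
    rw [this]
    exact integral_mono_measure (Measure.le_add_left (Measure.le_add_left le_rfl)) h0 hi

variable {X : Type*} [TopologicalSpace X] [MeasurableSpace X] [BorelSpace X]

/-- Partitions of unity can be approximated in `L¹` by continuous ones. -/
theorem IsPartitionOfUnity.exists_continuous_integral_sub_le [NormalSpace X] {k : ℕ} [NeZero k]
    {h : Fin k → X → ℝ} (hh : IsPartitionOfUnity k h) (σ : Measure X) [IsFiniteMeasure σ]
    [σ.WeaklyRegular] {ε : ℝ} (hε : 0 < ε) :
    ∃ g : Fin k → X → ℝ, IsPartitionOfUnity k g ∧ (∀ i, Continuous (g i)) ∧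
      ∀ i, ∫ x, |g i x - h i x| ∂σ ≤ ε := by
  have hk : (0 : ℝ) < k := by exact_mod_cast NeZero.pos k
  have hσ : 0 ≤ σ.real Set.univ := measureReal_nonneg
  set δ : ℝ := ε / (2 * k * (1 + σ.real Set.univ)) with hδ
  have hδ0 : 0 < δ := by positivity
  choose u hu hui using fun i =>
    (hh.integrable i σ).exists_boundedContinuous_integral_sub_le hδ0
  -- clipping at `δ` makes the functions positive, and dividing by their sum normalises them
  set v : Fin k → X → ℝ := fun i x => max (u i x) 0 + δ with hv
  have hv0 : ∀ i x, 0 < v i x := fun i x => by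
    have := le_max_right (u i x) 0
    simp only [hv]; linarith
  have hvc : ∀ i, Continuous (v i) := fun i =>
    ((u i).continuous.max continuous_const).add continuous_const
  have hvh : ∀ i x, |v i x - h i x| ≤ |h i x - u i x| + δ := fun i x => by
    have h1 : |max (u i x) 0 - max (h i x) 0| ≤ |u i x - h i x| := abs_max_sub_max_le_abs _ _ _
    rw [max_eq_left (hh.nonneg i x), abs_sub_comm (u i x)] at h1
    have h2 : v i x - h i x = (max (u i x) 0 - h i x) + δ := by simp only [hv]; ring
    rw [h2]
    refine (abs_add_le _ _).trans ?_
    rw [abs_of_pos hδ0]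
    linarith
  set s : X → ℝ := fun x => ∑ j, v j x with hs
  have hs0 : ∀ x, 0 < s x := fun x =>
    Finset.sum_pos (fun j _ => hv0 j x) Finset.univ_nonempty
  have hsc : Continuous s := continuous_finsetSum _ fun j _ => hvc j
  have hgc : ∀ i, Continuous fun x => v i x / s x := fun i =>
    (hvc i).div hsc fun x => (hs0 x).ne'
  have hg : IsPartitionOfUnity k fun i x => v i x / s x :=
    ⟨fun i => (hgc i).measurable, fun i x => (div_pos (hv0 i x) (hs0 x)).le,
      fun x => by rw [← Finset.sum_div]; exact div_self (hs0 x).ne'⟩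
  refine ⟨_, hg, hgc, fun i => ?_⟩
  have hpt : ∀ x, |v i x / s x - h i x| ≤ ∑ j, 2 * (|h j x - u j x| + δ) := fun x => by
    have h1 : v i x / s x - h i x =
        v i x / s x * (∑ j, (h j x - v j x)) + (v i x - h i x) := by
      rw [Finset.sum_sub_distrib, hh.sum_eq_one]
      change _ = v i x / s x * (1 - s x) + _
      field_simp [(hs0 x).ne']
      ring
    have h2 : |v i x / s x * ∑ j, (h j x - v j x)| ≤ ∑ j, (|h j x - u j x| + δ) := by
      rw [abs_mul, abs_of_nonneg (hg.nonneg i x)]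
      refine (mul_le_of_le_one_left (abs_nonneg _) (hg.le_one i x)).trans ?_
      refine (Finset.abs_sum_le_sum_abs _ _).trans (Finset.sum_le_sum fun j _ => ?_)
      rw [abs_sub_comm]
      exact hvh j x
    have h3 : |v i x - h i x| ≤ ∑ j, (|h j x - u j x| + δ) :=
      (hvh i x).trans (Finset.single_le_sum (f := fun j => |h j x - u j x| + δ)
        (fun j _ => by positivity) (Finset.mem_univ i))
    rw [h1, ← Finset.mul_sum]
    refine (abs_add_le _ _).trans ?_
    linarith
  have hint : ∀ j, Integrable (fun x => |h j x - u j x|) σ := fun j =>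
    ((hh.integrable j σ).sub (hui j)).abs
  have hint2 : ∀ j, Integrable (fun x => 2 * (|h j x - u j x| + δ)) σ := fun j =>
    ((hint j).add (integrable_const δ)).const_mul 2
  refine (integral_mono ((hg.integrable i σ).sub (hh.integrable i σ)).abs
    (integrable_finsetSum _ fun j _ => hint2 j) hpt).trans ?_
  rw [integral_finsetSum _ fun j _ => hint2 j]
  refine (Finset.sum_le_card_nsmul _ _ (2 * (δ * (1 + σ.real Set.univ))) fun j _ => ?_).trans ?_
  · rw [integral_const_mul, integral_add (hint j) (integrable_const δ)]
    have := hu j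
    simp only [Real.norm_eq_abs] at this
    simp only [integral_const, smul_eq_mul]
    nlinarith
  · simp only [Finset.card_univ, Fintype.card_fin, nsmul_eq_mul]
    refine le_of_eq ?_
    rw [hδ]
    field_simp

theorem tendsto_integral_of_continuous [CompactSpace X] {ι : Type*} {l : Filter ι}
    {ρs : ι → ProbabilityMeasure X}
    {ρ : ProbabilityMeasure X} (h : Tendsto ρs l (𝓝 ρ)) {g : X → ℝ} (hg : Continuous g) :
    Tendsto (fun i => ∫ x, g x ∂(ρs i : Measure X)) l (𝓝 (∫ x, g x ∂(ρ : Measure X))) :=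
  ProbabilityMeasure.tendsto_iff_forall_integral_tendsto.1 h
    (BoundedContinuousFunction.mkOfCompact ⟨g, hg⟩)

theorem tendsto_quotMat_of_continuous [CompactSpace X] [SecondCountableTopology X]
    {ι : Type*} {l : Filter ι} {ms : ι → FiniteMeasure (X × X)}
    {m : FiniteMeasure (X × X)} (h : Tendsto ms l (𝓝 m)) {k : ℕ} {g : Fin k → X → ℝ}
    (hg : ∀ i, Continuous (g i)) :
    Tendsto (fun i => quotMat (ms i : Measure (X × X)) g) l
      (𝓝 (quotMat (m : Measure (X × X)) g)) := by
  refine ((PiLp.continuous_toLp 1 _).tendsto _).comp (tendsto_pi_nhds.2 fun q => ?_)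
  have hc : Continuous fun p : X × X => g q.1 p.1 * g q.2 p.2 :=
    ((hg q.1).comp continuous_fst).mul ((hg q.2).comp continuous_snd)
  exact FiniteMeasure.tendsto_iff_forall_integral_tendsto.1 h
    (BoundedContinuousFunction.mkOfCompact ⟨_, hc⟩)

/-- Quotient matrices of a weak limit are limits of quotient matrices. Weak convergence controls
continuous partitions, and a measurable partition is approximated by continuous ones in `L¹` of
the base measure and of both marginals of the limit simultaneously. -/
theorem eventually_exists_mem_weightedShape_dist_lt [CompactSpace X] [T2Space X]
    [SecondCountableTopology X] {ι : Type*} {l : Filter ι}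
    {ρs : ι → ProbabilityMeasure X} {ρ : ProbabilityMeasure X} (hρ : Tendsto ρs l (𝓝 ρ))
    {ms : ι → FiniteMeasure (X × X)} {m : FiniteMeasure (X × X)} (hm : Tendsto ms l (𝓝 m))
    {k : ℕ} [NeZero k] {Y : EllOneMat k}
    (hY : Y ∈ weightedShape (ρ : Measure X) (m : Measure (X × X)) k) {ε : ℝ} (hε : 0 < ε) :
    ∀ᶠ i in l, ∃ Y' ∈ weightedShape (ρs i : Measure X) (ms i : Measure (X × X)) k,
      dist Y Y' < ε := by
  obtain ⟨h, hh, hhi, rfl⟩ := hY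
  set B : ℝ := (m : Measure (X × X)).real Set.univ + 1 with hB
  have hB0 : 0 < B := by positivity
  set δ : ℝ := ε / (2 + (k * k) * 2 + 4 * (k * k) * k * B) with hδ
  have hδ0 : 0 < δ := by positivity
  set σ : Measure X := (ρ : Measure X) + ((m : Measure (X × X)).fst + (m : Measure (X × X)).snd)
    with hσ
  obtain ⟨g, hg, hgc, hgσ⟩ := hh.exists_continuous_integral_sub_le σ hδ0
  have hcmp := fun i => integral_le_integral_add_marginals (ρ := (ρ : Measure X))
    (m := (m : Measure (X × X))) ((hg.measurable i).sub (hh.measurable i)).abs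
    (fun x => abs_nonneg _)
    ((hg.integrable i σ).sub (hh.integrable i σ)).abs
  simp only [Pi.sub_apply] at hcmp
  have hw : ∀ i, |∫ x, g i x ∂(ρ : Measure X) - 1 / (k : ℝ)| ≤ δ := fun i => by
    rw [← hhi i, ← integral_sub (hg.integrable i _) (hh.integrable i _)]
    exact abs_integral_le_integral_abs.trans ((hcmp i).1.trans (hgσ i))
  have hQ : dist (quotMat (m : Measure (X × X)) h) (quotMat (m : Measure (X × X)) g) ≤
      (k * k) * (2 * δ) := by
    rw [dist_comm, dist_ellOneMat]
    refine (Finset.sum_le_card_nsmul _ _ (2 * δ) fun q _ => ?_).trans (by simp)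
    refine (hg.abs_quotMat_sub_le hh _ q).trans ?_
    linarith [(hcmp q.1).2.1, (hcmp q.2).2.2, hgσ q.1, hgσ q.2]
  have e1 : ∀ᶠ i in l, ∀ a, |∫ x, g a x ∂(ρs i : Measure X) - 1 / (k : ℝ)| ≤ 2 * δ := by
    refine eventually_all.2 fun a => ?_
    have := (tendsto_integral_of_continuous hρ (hgc a)).eventually (Metric.ball_mem_nhds _ hδ0)
    filter_upwards [this] with i hi
    rw [Real.dist_eq] at hi
    calc _ ≤ _ := abs_sub_le _ (∫ x, g a x ∂(ρ : Measure X)) _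
      _ ≤ 2 * δ := by linarith [hw a]
  have e2 : ∀ᶠ i in l, dist (quotMat (ms i : Measure (X × X)) g)
      (quotMat (m : Measure (X × X)) g) < δ :=
    (tendsto_quotMat_of_continuous hm hgc).eventually (Metric.ball_mem_nhds _ hδ0)
  have e3 : ∀ᶠ i in l, (ms i : Measure (X × X)).real Set.univ ≤ B := by
    have h1 : Tendsto (fun i => (ms i : Measure (X × X)).real Set.univ) l
        (𝓝 ((m : Measure (X × X)).real Set.univ)) :=
      (NNReal.continuous_coe.tendsto _).comp (FiniteMeasure.continuous_mass.tendsto m |>.comp hm)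
    exact (h1.eventually (gt_mem_nhds (lt_add_one _))).mono fun i hi => hi.le
  filter_upwards [e1, e2, e3] with i h1 h2 h3
  obtain ⟨Y', hY', hd⟩ := hg.exists_mem_weightedShape_dist_le (ρs i : Measure X)
    (ms i : Measure (X × X)) (η := 2 * δ) (by positivity) h1
  refine ⟨Y', hY', ?_⟩
  have h4 : (k * k : ℝ) * (2 * (k * (2 * δ)) * (ms i : Measure (X × X)).real Set.univ) ≤
      (k * k : ℝ) * (2 * (k * (2 * δ)) * B) := by gcongr
  have h5 : dist (quotMat (m : Measure (X × X)) h) Y' ≤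
      (k * k) * (2 * δ) + δ + (k * k : ℝ) * (2 * (k * (2 * δ)) * B) := by
    refine (dist_triangle4 _ (quotMat (m : Measure (X × X)) g)
      (quotMat (ms i : Measure (X × X)) g) _).trans ?_
    rw [dist_comm _ Y', dist_comm (quotMat (m : Measure (X × X)) g)]
    linarith
  have h6 : δ * (2 + (k * k) * 2 + 4 * (k * k) * k * B) = ε := by
    rw [hδ]; field_simp
  nlinarith

end WeakLimits

/-! ### Limits of shapes are shapes -/

theorem infDist_le_dist_nonemptyCompacts {α : Type*} [MetricSpace α] {K L : NonemptyCompacts α}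
    {x : α} (hx : x ∈ (K : Set α)) : Metric.infDist x (L : Set α) ≤ dist K L := by
  rw [Metric.NonemptyCompacts.dist_eq]
  exact Metric.infDist_le_hausdorffDist_of_mem hx
    (Metric.hausdorffEDist_ne_top_of_nonempty_of_bounded K.nonempty L.nonempty
      K.isCompact.isBounded L.isCompact.isBounded)

theorem mem_of_infDist_le {α : Type*} [MetricSpace α] {K : NonemptyCompacts α}
    {x : α} (h : ∀ ε > 0, Metric.infDist x (K : Set α) ≤ ε) : x ∈ (K : Set α) := by
  rw [K.isCompact.isClosed.mem_iff_infDist_zero K.nonempty]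
  exact le_antisymm (le_of_forall_pos_le_add fun ε hε => by simpa using h ε hε)
    Metric.infDist_nonneg

theorem coe_shape (μ : Measure (Cantor × Cantor)) [IsFiniteMeasure μ] (k : ℕ) [NeZero k] :
    (shape μ k : Set (EllOneMat k)) = closure (weightedShape cantorMeasure μ k) :=
  congrArg closure (preShape_eq_weightedShape μ k)

/-- If the `k`-shapes of symmetric measures of bounded mass converge for every `k`, the limits are
the shapes of one symmetric measure.

Countably many fractional partitions, whose quotient matrices approximate a dense subset of each
limit, are packed into maps `F i` to a compact product of simplices. A weak limit of the images of
the measures under `F i` has the required shapes: the coordinates of the product realise the dense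
subsets, and no other quotient matrices arise since those of a weak limit are limits of quotient
matrices. The weak limit is then carried back to the Cantor space. -/
theorem exists_symMeasure_shape_eq {ι : Type*} (𝓕 : Ultrafilter ι) {c : ℝ≥0}
    (μ : ι → SymMeasure c) (L : ∀ m : ℕ, NonemptyCompacts (EllOneMat (m + 1)))
    (hL : ∀ m, Tendsto (fun i => shape (μ i).meas (m + 1)) 𝓕 (𝓝 (L m))) :
    ∃ μ' : SymMeasure c, ∀ m, shape μ'.meas (m + 1) = L m := by
  have hne : ∀ m, Nonempty (L m) := fun m => (L m).nonempty.to_subtype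
  let x : ∀ m, ℕ → EllOneMat (m + 1) := fun m l => (denseSeq (L m) l : EllOneMat (m + 1))
  have hx : ∀ m l, x m l ∈ (L m : Set (EllOneMat (m + 1))) := fun m l => (denseSeq (L m) l).2
  -- `j = (m, l, r)` stands for an approximation of the point `x m l` up to `1 / (r + 1)`
  have hex : ∀ (i : ι) (j : ℕ × ℕ × ℕ), ∃ f : Fin (j.1 + 1) → Cantor → ℝ,
      IsPartitionOfUnity (j.1 + 1) f ∧
      (∀ a, ∫ y, f a y ∂cantorMeasure = 1 / ((j.1 + 1 : ℕ) : ℝ)) ∧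
      dist (x j.1 j.2.1) (quotMat (μ i).meas f) <
        dist (L j.1) (shape (μ i).meas (j.1 + 1)) + 1 / ((j.2.2 : ℝ) + 1) := by
    intro i j
    have h1 := infDist_le_dist_nonemptyCompacts (L := shape (μ i).meas (j.1 + 1)) (hx j.1 j.2.1)
    have hpos : 0 < 1 / ((j.2.2 : ℝ) + 1) := by positivity
    have hne' : (weightedShape cantorMeasure (μ i).meas (j.1 + 1)).Nonempty := by
      rw [← preShape_eq_weightedShape]; exact preShape_nonempty _ _
    rw [coe_shape, Metric.infDist_closure] at h1
    obtain ⟨_, ⟨f, hf, hfi, rfl⟩, hd⟩ :=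
      (Metric.infDist_lt_iff hne').1 (h1.trans_lt (lt_add_of_pos_right _ hpos))
    exact ⟨f, hf, hfi, hd⟩
  choose f hf hfi hfd using hex
  let X : Type := ∀ j : ℕ × ℕ × ℕ, stdSimplex ℝ (Fin (j.1 + 1))
  let F : ι → Cantor → X := fun i y j =>
    ⟨fun a => f i j a y, fun a => (hf i j).nonneg a y, (hf i j).sum_eq_one y⟩
  have hF : ∀ i, Measurable (F i) := fun i => measurable_pi_lambda _ fun j =>
    (measurable_pi_lambda _ fun a => (hf i j).measurable a).subtype_mk
  have hsb : ∀ j : ℕ × ℕ × ℕ, StandardBorelSpace (stdSimplex ℝ (Fin (j.1 + 1))) := fun j =>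
    (isClosed_stdSimplex ℝ (Fin (j.1 + 1))).measurableSet.standardBorel
  have hXsb : StandardBorelSpace X := inferInstanceAs
    (StandardBorelSpace (∀ j : ℕ × ℕ × ℕ, stdSimplex ℝ (Fin (j.1 + 1))))
  -- the image measures and their weak limits
  let ρs : ι → ProbabilityMeasure X := fun i =>
    ⟨cantorMeasure.map (F i), Measure.isProbabilityMeasure_map (hF i).aemeasurable⟩
  let ms : ι → FiniteMeasure (X × X) := fun i =>
    ⟨(μ i).meas.map (Prod.map (F i) (F i)), inferInstance⟩
  have hmass : ∀ i, (ms i).mass ≤ c := by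
    intro i
    have h1 : ((ms i).mass : ℝ≥0∞) ≤ c := by
      rw [FiniteMeasure.ennreal_mass]
      change (μ i).meas.map (Prod.map (F i) (F i)) Set.univ ≤ c
      rw [Measure.map_apply ((hF i).prodMap (hF i)) MeasurableSet.univ]
      exact (μ i).2.2
    exact_mod_cast h1
  obtain ⟨ρ, hρ⟩ : ∃ ρ, Tendsto ρs 𝓕 (𝓝 ρ) := ⟨_, (𝓕.map ρs).le_nhds_lim⟩
  obtain ⟨m, hmc, hm⟩ : ∃ m ∈ {m : FiniteMeasure (X × X) | m.mass ≤ c}, Tendsto ms 𝓕 (𝓝 m) :=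
    (isCompact_setOfPred_finiteMeasure_le_of_compactSpace (X × X) c).ultrafilter_le_nhds
      (𝓕.map ms) (tendsto_principal.2 (Eventually.of_forall hmass))
  have hsymm : (m : Measure (X × X)).map Prod.swap = m := by
    have h1 := FiniteMeasure.tendsto_map_of_tendsto_of_continuous ms m hm continuous_swap
    have h2 : ∀ i, (ms i).map Prod.swap = ms i := by
      intro i
      refine Subtype.ext ?_
      change ((μ i).meas.map (Prod.map (F i) (F i))).map Prod.swap =
        (μ i).meas.map (Prod.map (F i) (F i))
      have h3 : (μ i).meas.map Prod.swap = (μ i).meas := (μ i).2.1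
      conv_rhs => rw [← h3]
      rw [Measure.map_map measurable_swap ((hF i).prodMap (hF i)),
        Measure.map_map ((hF i).prodMap (hF i)) measurable_swap]
      rfl
    simp_rw [h2] at h1
    exact congrArg (fun ν : FiniteMeasure (X × X) => (ν : Measure (X × X)))
      (tendsto_nhds_unique h1 hm)
  have hmu : (m : Measure (X × X)) Set.univ ≤ (c : ℝ≥0∞) := by
    rw [← FiniteMeasure.ennreal_mass]
    exact_mod_cast hmc
  have hXne : Nonempty X := by
    obtain ⟨i⟩ : Nonempty ι := 𝓕.nonempty_of_mem univ_mem |>.to_type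
    exact ⟨F i fun _ => false⟩
  obtain ⟨μ', hμ'⟩ := exists_symMeasure_weightedShape_eq (c := c) (ρ : Measure X)
    (m : Measure (X × X)) hsymm hmu
  refine ⟨μ', fun n => ?_⟩
  refine SetLike.coe_injective ?_
  rw [coe_shape, ← preShape_eq_weightedShape, hμ']
  refine Set.Subset.antisymm (closure_minimal ?_ (L n).isCompact.isClosed) ?_
  · intro Y hY
    refine mem_of_infDist_le fun ε hε => ?_
    have h1 := eventually_exists_mem_weightedShape_dist_lt hρ hm hY (half_pos hε)
    have h2 := (hL n).eventually (Metric.ball_mem_nhds _ (half_pos hε))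
    obtain ⟨i, ⟨Y', hY', hd⟩, hi⟩ := (h1.and h2).exists
    have h3 : Y' ∈ (shape (μ i).meas (n + 1) : Set (EllOneMat (n + 1))) := by
      rw [coe_shape]
      exact subset_closure (weightedShape_map_subset (hF i) cantorMeasure (μ i).meas _ hY')
    have h4 := infDist_le_dist_nonemptyCompacts (L := L n) h3
    have h5 : dist (shape (μ i).meas (n + 1)) (L n) < ε / 2 := hi
    have h6 := Metric.infDist_le_infDist_add_dist (s := (L n : Set (EllOneMat (n + 1))))
      (x := Y) (y := Y')
    linarith
  · have hdense : ∀ l, x n l ∈ closure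
        (weightedShape (ρ : Measure X) (m : Measure (X × X)) (n + 1)) := by
      intro l
      refine Metric.mem_closure_iff.2 fun ε hε => ?_
      obtain ⟨r, hr⟩ := exists_nat_one_div_lt hε
      let j : ℕ × ℕ × ℕ := (n, l, r)
      let p : Fin (n + 1) → X → ℝ := fun a y => (y j).1 a
      have hpc : ∀ a, Continuous (p a) := fun a =>
        (continuous_apply a).comp (continuous_subtype_val.comp (continuous_apply j))
      have hp : IsPartitionOfUnity (n + 1) p :=
        ⟨fun a => (hpc a).measurable, fun a y => (y j).2.1 a, fun y => (y j).2.2⟩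
      have hpF : ∀ i a y, p a (F i y) = f i j a y := fun i a y => rfl
      refine ⟨quotMat (m : Measure (X × X)) p, ⟨p, hp, fun a => ?_, rfl⟩, ?_⟩
      · refine tendsto_nhds_unique (tendsto_integral_of_continuous hρ (hpc a)) ?_
        have h1 : ∀ i, ∫ y, p a y ∂(ρs i : Measure X) = 1 / ((n + 1 : ℕ) : ℝ) := by
          intro i
          rw [← hfi i j a]
          exact integral_map (hF i).aemeasurable (hp.measurable a).aestronglyMeasurable
        simp_rw [h1]
        exact tendsto_const_nhds
      · refine lt_of_le_of_lt ?_ hr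
        have hq : ∀ i, quotMat (ms i : Measure (X × X)) p = quotMat (μ i).meas (f i j) := by
          intro i
          ext q
          exact integral_map ((hF i).prodMap (hF i)).aemeasurable
            (hp.integrable_mul _ _ _).aestronglyMeasurable
        have h1 : Tendsto (fun i => dist (x n l) (quotMat (ms i : Measure (X × X)) p)) 𝓕
            (𝓝 (dist (x n l) (quotMat (m : Measure (X × X)) p))) :=
          tendsto_const_nhds.dist (tendsto_quotMat_of_continuous hm hpc)
        have h2 : Tendsto (fun i => dist (L n) (shape (μ i).meas (n + 1)) + 1 / ((r : ℝ) + 1)) 𝓕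
            (𝓝 (dist (L n) (L n) + 1 / ((r : ℝ) + 1))) :=
          (tendsto_const_nhds.dist (hL n)).add_const _
        rw [dist_self, zero_add] at h2
        refine le_of_tendsto_of_tendsto' h1 h2 fun i => ?_
        rw [hq]
        exact (hfd i j).le
    intro Y hY
    refine closure_minimal (s := Set.range (x n)) ?_ isClosed_closure ?_
    · rintro _ ⟨l, rfl⟩
      exact hdense l
    · have h1 : (⟨Y, hY⟩ : L n) ∈ closure (Set.range (denseSeq (L n))) := denseRange_denseSeq _ _
      have h2 := image_closure_subset_closure_image
        (continuous_subtype_val (p := fun y => y ∈ L n)) (Set.mem_image_of_mem _ h1)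
      rwa [← Set.range_comp] at h2

/-! ### Matrices as measures on finite sets -/

section Matrices

/-- The uniform probability measure on `Fin n`, for `n ≠ 0`. -/
def finUniform (n : ℕ) : Measure (Fin n) := ∑ a : Fin n, (n : ℝ≥0∞)⁻¹ • Measure.dirac a

/-- The measure on `Fin n × Fin n` whose point masses are the entries of a nonnegative matrix. -/
def matrixMeasure {n : ℕ} (S : Matrix (Fin n) (Fin n) ℝ) : Measure (Fin n × Fin n) :=
  ∑ q : Fin n × Fin n, ENNReal.ofReal (S q.1 q.2) • Measure.dirac q

theorem integral_sum_smul_dirac {α : Type*} [Fintype α] [MeasurableSpace α]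
    [MeasurableSingletonClass α] {c : α → ℝ≥0∞} (hc : ∀ a, c a ≠ ∞) (f : α → ℝ) :
    ∫ x, f x ∂(∑ a, c a • Measure.dirac a) = ∑ a, (c a).toReal * f a := by
  rw [integral_finsetSum_measure fun a _ => (integrable_dirac (by simp)).smul_measure (hc a)]
  simp [integral_smul_measure, integral_dirac]

theorem isProbabilityMeasure_finUniform {n : ℕ} (hn : 0 < n) :
    IsProbabilityMeasure (finUniform n) := by
  refine ⟨?_⟩
  simp only [finUniform, Measure.coe_finsetSum, Finset.sum_apply, Measure.smul_apply,
    measure_univ, smul_eq_mul, mul_one, Finset.sum_const, Finset.card_univ, Fintype.card_fin,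
    nsmul_eq_mul]
  exact ENNReal.mul_inv_cancel (by exact_mod_cast hn.ne') (by simp)

theorem integral_finUniform {n : ℕ} (hn : 0 < n) (f : Fin n → ℝ) :
    ∫ a, f a ∂finUniform n = (∑ a, f a) / n := by
  rw [finUniform, integral_sum_smul_dirac fun a => by simpa using hn.ne', Finset.sum_div]
  exact Finset.sum_congr rfl fun a _ => by simp [div_eq_inv_mul]

theorem integral_matrixMeasure {n : ℕ} {S : Matrix (Fin n) (Fin n) ℝ} (hS : IsSymmNonneg S)
    (f : Fin n × Fin n → ℝ) : ∫ q, f q ∂matrixMeasure S = ∑ q, S q.1 q.2 * f q := by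
  rw [matrixMeasure, integral_sum_smul_dirac fun a => ENNReal.ofReal_ne_top]
  exact Finset.sum_congr rfl fun q _ => by rw [ENNReal.toReal_ofReal (hS.2 _ _)]

theorem matrixMeasure_univ {n : ℕ} {S : Matrix (Fin n) (Fin n) ℝ} (hS : IsSymmNonneg S) :
    matrixMeasure S Set.univ = ENNReal.ofReal (entrySum S) := by
  simp only [matrixMeasure, Measure.coe_finsetSum, Finset.sum_apply, Measure.smul_apply,
    measure_univ, smul_eq_mul, mul_one]
  rw [← ENNReal.ofReal_sum_of_nonneg fun q _ => hS.2 _ _, entrySum, Fintype.sum_prod_type]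

theorem matrixMeasure_map_swap {n : ℕ} {S : Matrix (Fin n) (Fin n) ℝ} (hS : IsSymmNonneg S) :
    (matrixMeasure S).map Prod.swap = matrixMeasure S := by
  rw [matrixMeasure, Measure.map_finset_sum measurable_swap.aemeasurable]
  simp_rw [Measure.map_smul, Measure.map_dirac' measurable_swap]
  refine Fintype.sum_equiv (Equiv.prodComm _ _) _ _ fun q => ?_
  have : S q.1 q.2 = S q.2 q.1 := hS.1.apply q.2 q.1
  simp [this]

theorem toLp_mul_mul_transpose {n k : ℕ} {S : Matrix (Fin n) (Fin n) ℝ} (hS : IsSymmNonneg S)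
    (M : Matrix (Fin k) (Fin n) ℝ) :
    (WithLp.toLp 1 fun q => (M * S * M.transpose) q.1 q.2 : EllOneMat k) =
      quotMat (matrixMeasure S) fun i a => M i a := by
  ext q
  rw [quotMat_apply, integral_matrixMeasure hS, Fintype.sum_prod_type]
  simp only [Matrix.mul_apply, Matrix.transpose_apply, Finset.sum_mul]
  rw [Finset.sum_comm]
  exact Finset.sum_congr rfl fun a _ => Finset.sum_congr rfl fun b _ => by ring

theorem mem_balancedMatrices_iff {n k : ℕ} (hn : 0 < n) (M : Matrix (Fin k) (Fin n) ℝ) :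
    M ∈ balancedMatrices k n ↔ IsPartitionOfUnity k (fun i a => M i a) ∧
      ∀ i, ∫ a, M i a ∂finUniform n = 1 / (k : ℝ) := by
  have hn' : (n : ℝ) ≠ 0 := by exact_mod_cast hn.ne'
  have key : ∀ i, ∫ a, M i a ∂finUniform n = 1 / (k : ℝ) ↔ ∑ a, M i a = (n : ℝ) / k := by
    intro i
    rw [integral_finUniform hn, div_eq_iff hn', one_div_mul_eq_div]
  simp_rw [key]
  constructor
  · rintro ⟨h1, h2, h3⟩
    exact ⟨⟨fun i => measurable_of_countable _, h1, h3⟩, h2⟩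
  · rintro ⟨h, h2⟩
    exact ⟨h.nonneg, h2, h.sum_eq_one⟩

theorem matrixShapeSet_eq_weightedShape {n : ℕ} (hn : 0 < n) {S : Matrix (Fin n) (Fin n) ℝ}
    (hS : IsSymmNonneg S) (k : ℕ) :
    matrixShapeSet S k = weightedShape (finUniform n) (matrixMeasure S) k := by
  ext X
  constructor
  · rintro ⟨M, hM, rfl⟩
    obtain ⟨h1, h2⟩ := (mem_balancedMatrices_iff hn M).1 hM
    exact ⟨_, h1, h2, toLp_mul_mul_transpose hS M⟩
  · rintro ⟨f, hf, hfi, rfl⟩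
    exact ⟨Matrix.of f, (mem_balancedMatrices_iff hn _).2 ⟨hf, hfi⟩, toLp_mul_mul_transpose hS _⟩

/-- Nonnegative symmetric matrices have the same shapes as suitable symmetric measures. -/
theorem exists_symMeasure_shape_eq_matrixShape {c : ℝ≥0} {n : ℕ} (hn : 0 < n)
    {S : Matrix (Fin n) (Fin n) ℝ} (hS : IsSymmNonneg S) (hc : entrySum S ≤ c) :
    ∃ μ : SymMeasure c, ∀ (k : ℕ) [NeZero k], shape μ.meas k = matrixShape S k := by
  have := isProbabilityMeasure_finUniform hn
  have : Nonempty (Fin n) := ⟨⟨0, hn⟩⟩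
  obtain ⟨μ, hμ⟩ := exists_symMeasure_weightedShape_eq (c := c) (finUniform n) (matrixMeasure S)
    (matrixMeasure_map_swap hS) (by
      rw [matrixMeasure_univ hS]
      exact ENNReal.ofReal_le_of_le_toReal (by simpa using hc))
  refine ⟨μ, fun k _ => SetLike.coe_injective ?_⟩
  change closure (preShape μ.meas k) = matrixShapeSet S k
  rw [hμ, ← matrixShapeSet_eq_weightedShape hn hS]
  exact (matrixShape S k).isCompact.isClosed.closure_eq

end Matrices

/-! ### Approximation of measures by matrices -/

section Approximation

variable {Ω : Type*} [MeasurableSpace Ω]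

/-- The matrix of all integrals `∫ g_a(x) g_b(y) dμ(x,y)`. -/
def overlapMatrix (μ : Measure (Ω × Ω)) {n : ℕ} (g : Fin n → Ω → ℝ) : Matrix (Fin n) (Fin n) ℝ :=
  Matrix.of fun a b => ∫ p, g a p.1 * g b p.2 ∂μ

theorem isSymmNonneg_overlapMatrix {μ : Measure (Ω × Ω)} (hμ : μ.map Prod.swap = μ) {n : ℕ}
    {g : Fin n → Ω → ℝ} (hg : IsPartitionOfUnity n g) [IsFiniteMeasure μ] :
    IsSymmNonneg (overlapMatrix μ g) := by
  refine ⟨Matrix.IsSymm.ext fun a b => ?_, fun a b =>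
    integral_nonneg fun p => mul_nonneg (hg.nonneg _ _) (hg.nonneg _ _)⟩
  change ∫ p, g b p.1 * g a p.2 ∂μ = ∫ p, g a p.1 * g b p.2 ∂μ
  conv_lhs => rw [← hμ]
  rw [integral_map measurable_swap.aemeasurable
    (hg.integrable_mul b a _).aestronglyMeasurable]
  exact integral_congr_ae (Eventually.of_forall fun p => mul_comm _ _)

theorem entrySum_overlapMatrix (μ : Measure (Ω × Ω)) [IsFiniteMeasure μ] {n : ℕ}
    {g : Fin n → Ω → ℝ} (hg : IsPartitionOfUnity n g) :
    entrySum (overlapMatrix μ g) = μ.real Set.univ := by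
  simp only [entrySum, overlapMatrix, Matrix.of_apply]
  simp_rw [← integral_finsetSum _ fun b _ => hg.integrable_mul _ b μ, ← Finset.mul_sum,
    hg.sum_eq_one, mul_one]
  rw [← integral_finsetSum _ fun a _ => hg.integrable_fst a μ]
  simp [hg.sum_eq_one]

/-- Merging the parts of `g` with weights `M` corresponds to conjugating its matrix by `M`. -/
theorem overlapMatrix_conj (μ : Measure (Ω × Ω)) [IsFiniteMeasure μ] {n k : ℕ}
    {g : Fin n → Ω → ℝ} (hg : IsPartitionOfUnity n g) (M : Matrix (Fin k) (Fin n) ℝ) :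
    (WithLp.toLp 1 fun q => (M * overlapMatrix μ g * M.transpose) q.1 q.2 : EllOneMat k) =
      quotMat μ fun i x => ∑ a, M i a * g a x := by
  ext q
  rw [quotMat_apply]
  change (M * overlapMatrix μ g * M.transpose) q.1 q.2 = _
  have h : ∀ p : Ω × Ω, (∑ a, M q.1 a * g a p.1) * (∑ b, M q.2 b * g b p.2) =
      ∑ a, ∑ b, M q.1 a * M q.2 b * (g a p.1 * g b p.2) := fun p => by
    rw [Finset.sum_mul_sum]
    exact Finset.sum_congr rfl fun a _ => Finset.sum_congr rfl fun b _ => by ring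
  have hint := fun a b => (hg.integrable_mul a b μ).const_mul (M q.1 a * M q.2 b)
  simp_rw [h]
  rw [integral_finsetSum _ fun a _ => integrable_finsetSum _ fun b _ => hint a b]
  simp_rw [integral_finsetSum _ fun b _ => hint _ b, integral_const_mul]
  simp only [Matrix.mul_apply, Matrix.transpose_apply, Finset.sum_mul, overlapMatrix,
    Matrix.of_apply]
  rw [Finset.sum_comm]
  exact Finset.sum_congr rfl fun a _ => Finset.sum_congr rfl fun b _ => by ring

theorem IsPartitionOfUnity.merge {n k : ℕ} {g : Fin n → Ω → ℝ} (hg : IsPartitionOfUnity n g)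
    {M : Fin k → Fin n → ℝ} (hM : IsPartitionOfUnity k M) :
    IsPartitionOfUnity k fun i x => ∑ a, M i a * g a x := by
  refine ⟨fun i => Finset.measurable_sum _ fun a _ => (hg.measurable a).const_mul _,
    fun i x => Finset.sum_nonneg fun a _ => mul_nonneg (hM.nonneg i a) (hg.nonneg a x),
    fun x => ?_⟩
  rw [Finset.sum_comm]
  simp_rw [← Finset.sum_mul, hM.sum_eq_one, one_mul]
  exact hg.sum_eq_one x

theorem IsPartitionOfUnity.integral_merge {n k : ℕ} (hn : 0 < n) {g : Fin n → Ω → ℝ}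
    (hg : IsPartitionOfUnity n g) {ν : Measure Ω} [IsFiniteMeasure ν]
    (hgi : ∀ a, ∫ x, g a x ∂ν = 1 / (n : ℝ)) (M : Fin k → Fin n → ℝ) (i : Fin k) :
    ∫ x, ∑ a, M i a * g a x ∂ν = ∫ a, M i a ∂finUniform n := by
  rw [integral_finUniform hn, integral_finsetSum _ fun a _ => (hg.integrable a ν).const_mul _,
    Finset.sum_div]
  exact Finset.sum_congr rfl fun a _ => by rw [integral_const_mul, hgi, mul_one_div]

theorem matrixShapeSet_overlapMatrix_subset {n : ℕ} (hn : 0 < n) {g : Fin n → Ω → ℝ}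
    (hg : IsPartitionOfUnity n g) {ν : Measure Ω} [IsFiniteMeasure ν]
    (hgi : ∀ a, ∫ x, g a x ∂ν = 1 / (n : ℝ)) (μ : Measure (Ω × Ω)) [IsFiniteMeasure μ] (k : ℕ) :
    matrixShapeSet (overlapMatrix μ g) k ⊆ weightedShape ν μ k := by
  rintro _ ⟨M, hM, rfl⟩
  obtain ⟨h1, h2⟩ := (mem_balancedMatrices_iff hn M).1 hM
  refine ⟨_, hg.merge h1, fun i => ?_, overlapMatrix_conj μ hg M⟩
  rw [hg.integral_merge hn hgi (fun i a => M i a), h2]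

/-- A finite measurable colouring `Φ` can be refined, up to a uniformly small error, by a
partition into `n` parts of equal weight. The part belonging to a colour may not be taken
proportional to its indicator, since colours of weight `0` need to keep a part of their own;
mixing in small constants makes all weights positive multiples of `1 / n`. -/
theorem exists_equal_weights_refinement {Z : Type*} [Fintype Z] [Nonempty Z] [MeasurableSpace Z]
    [MeasurableSingletonClass Z] (ν : Measure Ω) [IsProbabilityMeasure ν] {Φ : Ω → Z}
    (hΦ : Measurable Φ) {ε : ℝ} (hε : 0 < ε) :
    ∃ (n : ℕ) (g : Fin n → Ω → ℝ) (col : Fin n → Z), 0 < n ∧ IsPartitionOfUnity n g ∧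
      (∀ a, ∫ x, g a x ∂ν = 1 / (n : ℝ)) ∧
      ∀ v : Z → ℝ, (∀ z, 0 ≤ v z) → (∀ z, v z ≤ 1) →
        ∀ x, |∑ a, v (col a) * g a x - v (Φ x)| ≤ ε := by
  classical
  set r : ℝ := (Fintype.card Z : ℝ) with hr
  have hr0 : 0 < r := by rw [hr]; exact_mod_cast Fintype.card_pos
  obtain ⟨N, hN⟩ := exists_nat_gt (r / ε)
  have hN0 : (0 : ℝ) < N := (div_pos hr0 hε).trans hN
  set β : Z → ℝ := fun z => ν.real (Φ ⁻¹' {z}) with hβ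
  have hβ0 : ∀ z, 0 ≤ β z := fun z => measureReal_nonneg
  have hmeas : ∀ z, MeasurableSet (Φ ⁻¹' {z}) := fun z => hΦ (measurableSet_singleton z)
  have hind : ∀ z, Integrable ((Φ ⁻¹' {z}).indicator (1 : Ω → ℝ)) ν := fun z =>
    (integrable_const (1 : ℝ)).indicator (hmeas z)
  have hβs : ∑ z, β z = 1 := by
    have h1 : ∀ z, β z = ∫ x, (Φ ⁻¹' {z}).indicator 1 x ∂ν := fun z => by
      rw [integral_indicator_one (hmeas z)]
    simp_rw [h1]
    rw [← integral_finsetSum _ fun z _ => hind z]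
    have h2 : ∀ x, ∑ z, (Φ ⁻¹' {z}).indicator (1 : Ω → ℝ) x = 1 := fun x => by
      simp [Set.indicator_apply]
    simp_rw [h2]
    simp
  -- the colour `z` gets `w z ≥ 1` of the `n` parts, even if its weight `β z` is zero
  set w : Z → ℕ := fun z => ⌊N * β z⌋₊ + 1 with hw
  have hwl : ∀ z, N * β z ≤ w z := fun z => by
    have := (Nat.lt_floor_add_one (N * β z)).le
    simpa [hw] using this
  have hwu : ∀ z, (w z : ℝ) ≤ N * β z + 1 := fun z => by
    have := Nat.floor_le (mul_nonneg hN0.le (hβ0 z))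
    simpa [hw] using this
  have hw0 : ∀ z, (0 : ℝ) < w z := fun z => by simp only [hw]; positivity
  set n : ℕ := Fintype.card (Σ z, Fin (w z)) with hn
  have hnw : (n : ℝ) = ∑ z, (w z : ℝ) := by rw [hn, Fintype.card_sigma]; simp
  have hn0 : (0 : ℝ) < n := by
    rw [hnw]
    exact Finset.sum_pos (fun z _ => hw0 z) Finset.univ_nonempty
  have hnu : (n : ℝ) ≤ N + r := by
    rw [hnw]
    refine (Finset.sum_le_sum fun z _ => hwu z).trans (le_of_eq ?_)
    rw [Finset.sum_add_distrib, ← Finset.mul_sum, hβs]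
    simp [hr]
  set t : ℝ := r / (N + r) with ht
  have ht0 : 0 < t := by positivity
  have ht1 : 1 - t = N / (N + r) := by rw [ht]; field_simp; ring
  have htε : t ≤ ε := by
    rw [ht, div_le_iff₀ (by positivity)]
    rw [div_lt_iff₀ hε] at hN
    nlinarith
  -- `q` compensates the difference between the rational weights `w z / n` and `β z`
  set q : Z → ℝ := fun z => (w z / n - (1 - t) * β z) / t with hq
  have hq0 : ∀ z, 0 ≤ q z := fun z => by
    refine div_nonneg ?_ ht0.le
    rw [ht1, sub_nonneg, div_mul_eq_mul_div]
    exact div_le_div₀ (hw0 z).le (hwl z) hn0 hnu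
  have hqs : ∑ z, q z = 1 := by
    rw [hq, ← Finset.sum_div, Finset.sum_sub_distrib, ← Finset.mul_sum, hβs, ← Finset.sum_div,
      ← hnw, div_self hn0.ne']
    field_simp
    ring
  let e : Fin n ≃ Σ z, Fin (w z) := (Fintype.equivFin _).symm
  let b : Z → Ω → ℝ := fun z x => (1 - t) * (Φ ⁻¹' {z}).indicator 1 x + t * q z
  have hb0 : ∀ z x, 0 ≤ b z x := fun z x => by
    have h1 : 0 ≤ (Φ ⁻¹' {z}).indicator (1 : Ω → ℝ) x :=
      Set.indicator_nonneg (fun _ _ => zero_le_one) x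
    have h2 : 0 ≤ 1 - t := by rw [ht1]; positivity
    have h3 := hq0 z
    simp only [b]
    positivity
  have hbi : ∀ z, ∫ x, b z x ∂ν = w z / n := fun z => by
    simp only [b]
    rw [integral_add ((hind z).const_mul _) (integrable_const _), integral_const_mul,
      integral_indicator_one (hmeas z)]
    simp only [integral_const, probReal_univ, one_smul, hq]
    field_simp
    ring
  have hsum : ∀ (v : Z → ℝ) (x : Ω), ∑ a, v (e a).1 * (b (e a).1 x / w (e a).1) =
      (1 - t) * v (Φ x) + t * ∑ z, v z * q z := fun v x => by
    rw [e.sum_comp fun s : Σ z, Fin (w z) => v s.1 * (b s.1 x / w s.1), Fintype.sum_sigma]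
    have h1 : ∀ z, ∑ _i : Fin (w z), v z * (b z x / w z) =
        (1 - t) * (v z * (Φ ⁻¹' {z}).indicator 1 x) + t * (v z * q z) := fun z => by
      have := (hw0 z).ne'
      simp only [Finset.sum_const, Finset.card_univ, Fintype.card_fin, nsmul_eq_mul, b]
      field_simp
    simp_rw [h1]
    rw [Finset.sum_add_distrib, ← Finset.mul_sum, ← Finset.mul_sum]
    simp [Set.indicator_apply]
  refine ⟨n, fun a x => b (e a).1 x / w (e a).1, fun a => (e a).1, by exact_mod_cast hn0,
    ⟨fun a => ?_, fun a x => div_nonneg (hb0 _ x) (hw0 _).le, fun x => ?_⟩, fun a => ?_,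
    fun v hv0 hv1 x => ?_⟩
  · exact (((measurable_const.indicator (hmeas _)).const_mul _).add_const _).div_const _
  · have := hsum (fun _ => 1) x
    simp only [one_mul, hqs] at this
    rw [this]
    ring
  · rw [integral_div, hbi]
    have := (hw0 (e a).1).ne'
    field_simp
  · rw [hsum]
    have h1 : 0 ≤ ∑ z, v z * q z := Finset.sum_nonneg fun z _ => mul_nonneg (hv0 z) (hq0 z)
    have h2 : ∑ z, v z * q z ≤ 1 := by
      rw [← hqs]
      exact Finset.sum_le_sum fun z _ => mul_le_of_le_one_left (hq0 z) (hv1 z)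
    have h3 : (1 - t) * v (Φ x) + t * ∑ z, v z * q z - v (Φ x) =
        t * (∑ z, v z * q z - v (Φ x)) := by ring
    rw [h3, abs_mul, abs_of_pos ht0]
    have h4 : |∑ z, v z * q z - v (Φ x)| ≤ 1 := by
      rw [abs_le]
      constructor <;> linarith [hv0 (Φ x), hv1 (Φ x)]
    nlinarith [abs_nonneg (∑ z, v z * q z - v (Φ x))]

/-- Finitely many partitions of unity are uniformly approximated by functions of one finite
measurable colouring. -/
theorem exists_finite_colouring [Nonempty Ω] {J : Type*} [Finite J] {k : J → ℕ}
    {f : ∀ j, Fin (k j) → Ω → ℝ} (hf : ∀ j, IsPartitionOfUnity (k j) (f j)) {ε : ℝ} (hε : 0 < ε) :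
    ∃ (d : ℕ) (Φ : Ω → Fin (d + 1)) (v : ∀ j, Fin (k j) → Fin (d + 1) → ℝ), Measurable Φ ∧
      (∀ j, IsPartitionOfUnity (k j) (v j)) ∧ ∀ j i x, |v j i (Φ x) - f j i x| ≤ ε := by
  classical
  have := Fintype.ofFinite J
  obtain ⟨R, hR⟩ := exists_nat_gt (1 / ε)
  have hR0 : (0 : ℝ) < R := (by positivity : (0 : ℝ) < 1 / ε).trans hR
  let Z : Type _ := (Σ j, Fin (k j)) → Fin (R + 1)
  -- the colour of a point records all values rounded down to multiples of `1 / R`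
  let Φ : Ω → Z := fun x s => Fin.ofNat (R + 1) ⌊R * f s.1 s.2 x⌋₊
  have hΦ : Measurable Φ := measurable_pi_lambda _ fun s =>
    (measurable_of_countable (Fin.ofNat (R + 1))).comp
      (((hf s.1).measurable s.2).const_mul (R : ℝ)).nat_floor
  have hclose : ∀ x y, Φ x = Φ y → ∀ j i, |f j i x - f j i y| ≤ ε := by
    intro x y hxy j i
    have h1 := congrArg Fin.val (congrFun hxy ⟨j, i⟩)
    have hlt : ∀ z, ⌊R * f j i z⌋₊ < R + 1 := fun z => by
      rw [Nat.lt_add_one_iff]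
      refine Nat.floor_le_of_le ?_
      exact mul_le_of_le_one_right hR0.le ((hf j).le_one i z)
    have h2 : ⌊R * f j i x⌋₊ = ⌊R * f j i y⌋₊ := by
      simpa [Φ, Fin.ofNat, Nat.mod_eq_of_lt (hlt x), Nat.mod_eq_of_lt (hlt y)] using h1
    have hx0 := Nat.floor_le (mul_nonneg hR0.le ((hf j).nonneg i x))
    have hy0 := Nat.floor_le (mul_nonneg hR0.le ((hf j).nonneg i y))
    have hx1 := Nat.lt_floor_add_one (R * f j i x)
    have hy1 := Nat.lt_floor_add_one (R * f j i y)
    rw [h2] at hx0 hx1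
    have h3 : R * |f j i x - f j i y| ≤ 1 := by
      rw [← abs_of_pos hR0, ← abs_mul, abs_le]
      constructor <;> linarith
    rw [div_lt_iff₀ hε] at hR
    exact le_of_mul_le_mul_left (h3.trans hR.le) hR0
  have : Nonempty Z := ⟨Φ (Classical.arbitrary Ω)⟩
  obtain ⟨d, hd⟩ : ∃ d, Fintype.card Z = d + 1 :=
    Nat.exists_eq_succ_of_ne_zero Fintype.card_ne_zero
  let e : Z ≃ Fin (d + 1) := Fintype.equivFinOfCardEq hd
  let s : Fin (d + 1) → Ω := Function.invFun (e ∘ Φ)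
  refine ⟨d, e ∘ Φ, fun j i z => f j i (s z), (measurable_of_countable e).comp hΦ,
    fun j => (hf j).comp (measurable_of_countable s), fun j i x => ?_⟩
  refine hclose _ _ (e.injective ?_) j i
  exact Function.invFun_eq (f := e ∘ Φ) ⟨x, rfl⟩

/-- For every finite family of fractional partitions, some matrix of overlaps has, near each of
them, a quotient. -/
theorem exists_overlapMatrix_approx [Nonempty Ω] (ν : Measure Ω) [IsProbabilityMeasure ν]
    (μ : Measure (Ω × Ω)) [IsFiniteMeasure μ] {J : Type*} [Finite J] {k : J → ℕ}
    [∀ j, NeZero (k j)] {f : ∀ j, Fin (k j) → Ω → ℝ} (hf : ∀ j, IsPartitionOfUnity (k j) (f j))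
    (hfi : ∀ j i, ∫ x, f j i x ∂ν = 1 / (k j : ℝ)) {ε : ℝ} (hε : 0 < ε) :
    ∃ (n : ℕ) (g : Fin n → Ω → ℝ), 0 < n ∧ IsPartitionOfUnity n g ∧
      (∀ a, ∫ x, g a x ∂ν = 1 / (n : ℝ)) ∧
      ∀ j, ∃ Y ∈ matrixShapeSet (overlapMatrix μ g) (k j), dist (quotMat μ (f j)) Y ≤
        (k j * k j) * (2 * ((k j + 1) * (2 * ε)) * μ.real Set.univ) := by
  obtain ⟨d, Φ, v, hΦ, hv, hvf⟩ := exists_finite_colouring hf hε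
  obtain ⟨n, g, col, hn, hg, hgi, hcol⟩ := exists_equal_weights_refinement ν hΦ hε
  refine ⟨n, g, hn, hg, hgi, fun j => ?_⟩
  have := isProbabilityMeasure_finUniform hn
  -- each part of `g` is assigned according to its colour, and the matrix of this assignment is
  -- then corrected to a balanced one
  have hM : IsPartitionOfUnity (k j) fun i a => v j i (col a) :=
    (hv j).comp (measurable_of_countable col)
  have hh := hg.merge hM
  have hhf : ∀ i x, |∑ a, v j i (col a) * g a x - f j i x| ≤ 2 * ε := fun i x => by
    refine (abs_sub_le _ (v j i (Φ x)) _).trans ?_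
    linarith [hcol (v j i) ((hv j).nonneg i) ((hv j).le_one i) x, hvf j i x]
  have hw : ∀ i, |∫ a, v j i (col a) ∂finUniform n - 1 / (k j : ℝ)| ≤ 2 * ε := fun i => by
    rw [← hg.integral_merge hn hgi (fun i a => v j i (col a)) i, ← hfi j i,
      ← integral_sub (hh.integrable i ν) ((hf j).integrable i ν)]
    refine abs_integral_le_integral_abs.trans ?_
    refine (integral_mono ((hh.integrable i ν).sub ((hf j).integrable i ν)).abs
      (integrable_const (2 * ε)) fun x => hhf i x).trans ?_
    simp
  obtain ⟨M', hM', hM'i, hM'v⟩ := hM.exists_equal_weights (finUniform n) (by positivity) hw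
  refine ⟨_, ⟨Matrix.of M', (mem_balancedMatrices_iff hn _).2 ⟨hM', hM'i⟩, rfl⟩, ?_⟩
  have hconj := overlapMatrix_conj μ hg (Matrix.of M')
  simp only at hconj ⊢
  rw [hconj]
  refine (hf j).dist_quotMat_le (hg.merge hM') μ fun i x => ?_
  have h1 : |∑ a, M' i a * g a x - ∑ a, v j i (col a) * g a x| ≤ k j * (2 * ε) := by
    rw [← Finset.sum_sub_distrib]
    simp_rw [← sub_mul]
    refine (Finset.abs_sum_le_sum_abs _ _).trans ?_
    have h2 : ∀ a ∈ Finset.univ, |(M' i a - v j i (col a)) * g a x| ≤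
        k j * (2 * ε) * g a x := fun a _ => by
      rw [abs_mul, abs_of_nonneg (hg.nonneg a x)]
      exact mul_le_mul_of_nonneg_right (hM'v i a) (hg.nonneg a x)
    refine (Finset.sum_le_sum h2).trans (le_of_eq ?_)
    rw [← Finset.mul_sum, hg.sum_eq_one, mul_one]
  rw [abs_sub_comm]
  refine (abs_sub_le _ (∑ a, v j i (col a) * g a x) _).trans ?_
  have h3 := hhf i x
  linarith

end Approximation

/-- Compact subsets of a compact set converge to it as soon as they come close to every point of
a dense sequence. -/
theorem tendsto_nonemptyCompacts_of_subset {α ι : Type*} [MetricSpace α] {l : Filter ι}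
    {Ks : ι → NonemptyCompacts α} {K : NonemptyCompacts α}
    (hsub : ∀ i, (Ks i : Set α) ⊆ K) {x : ℕ → α} (hx : (K : Set α) ⊆ closure (Set.range x))
    (h : ∀ m, Tendsto (fun i => Metric.infDist (x m) (Ks i : Set α)) l (𝓝 0)) :
    Tendsto Ks l (𝓝 K) := by
  rw [Metric.tendsto_nhds]
  intro ε hε
  have hε3 : 0 < ε / 3 := by positivity
  obtain ⟨t, ht⟩ := K.isCompact.elim_finite_subcover (fun m => Metric.ball (x m) (ε / 3))
    (fun m => Metric.isOpen_ball) fun y hy => by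
      obtain ⟨_, ⟨m, rfl⟩, hm⟩ := Metric.mem_closure_iff.1 (hx hy) _ hε3
      exact Set.mem_iUnion.2 ⟨m, hm⟩
  have hev : ∀ᶠ i in l, ∀ m ∈ t, Metric.infDist (x m) (Ks i : Set α) < ε / 3 :=
    (Finset.eventually_all t).2 fun m _ => (h m).eventually (gt_mem_nhds hε3)
  filter_upwards [hev] with i hi
  rw [Metric.NonemptyCompacts.dist_eq]
  refine lt_of_le_of_lt (Metric.hausdorffDist_le_of_infDist (r := 2 * (ε / 3)) (by positivity)
    (fun y hy => ?_) fun y hy => ?_) (by linarith)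
  · rw [Metric.infDist_zero_of_mem (hsub i hy)]
    positivity
  · obtain ⟨m, hm, hy'⟩ := Set.mem_iUnion₂.1 (ht hy)
    have h1 := Metric.infDist_le_infDist_add_dist (s := (Ks i : Set α)) (x := y) (y := x m)
    have h2 := hi m hm
    rw [Metric.mem_ball] at hy'
    linarith

/-- Every symmetric measure is a limit of nonnegative symmetric matrices of the same mass. -/
theorem exists_shapeTendsto {c : ℝ≥0} (μ : SymMeasure c) :
    ∃ (n : ℕ → ℕ) (S : ∀ i, Matrix (Fin (n i)) (Fin (n i)) ℝ),
      (∀ i, 0 < n i) ∧ (∀ i, IsSymmNonneg (S i)) ∧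
      (∀ i, entrySum (S i) = μ.meas.real Set.univ) ∧ ShapeTendsto S μ := by
  have hne : ∀ m, Nonempty (weightedShape cantorMeasure μ.meas (m + 1)) := fun m => by
    rw [← preShape_eq_weightedShape]
    exact (preShape_nonempty _ _).to_subtype
  let x : ∀ m, ℕ → EllOneMat (m + 1) := fun m l =>
    (denseSeq (weightedShape cantorMeasure μ.meas (m + 1)) l : EllOneMat (m + 1))
  have hx : ∀ m l, x m l ∈ weightedShape cantorMeasure μ.meas (m + 1) := fun m l =>
    (denseSeq (weightedShape cantorMeasure μ.meas (m + 1)) l).2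
  choose f hf hfi hfx using hx
  have happ := fun i : ℕ => exists_overlapMatrix_approx cantorMeasure μ.meas
    (J := Fin i × Fin i) (k := fun j => j.1 + 1) (f := fun j => f j.1 j.2)
    (fun j => hf j.1 j.2) (fun j a => hfi j.1 j.2 a) (ε := 1 / ((i : ℝ) + 1)) (by positivity)
  choose n g hn hg hgi hY using happ
  refine ⟨n, fun i => overlapMatrix μ.meas (g i), hn,
    fun i => isSymmNonneg_overlapMatrix (μ := μ.meas) μ.2.1 (hg i),
    fun i => entrySum_overlapMatrix μ.meas (hg i), fun k hk => ?_⟩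
  obtain ⟨m, rfl⟩ := Nat.exists_eq_succ_of_ne_zero hk.out
  refine tendsto_nonemptyCompacts_of_subset (x := x m) (fun i => ?_) ?_ fun l => ?_
  · rw [coe_shape]
    exact (matrixShapeSet_overlapMatrix_subset (hn i) (hg i) (hgi i) _ _).trans subset_closure
  · rw [coe_shape]
    refine closure_minimal (fun Y hY' => ?_) isClosed_closure
    have h1 : (⟨Y, hY'⟩ : weightedShape cantorMeasure μ.meas (m + 1)) ∈
        closure (Set.range (denseSeq _)) := denseRange_denseSeq _ _
    have h2 := image_closure_subset_closure_image
      (continuous_subtype_val (p := fun y => y ∈ weightedShape cantorMeasure μ.meas (m + 1)))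
      (Set.mem_image_of_mem _ h1)
    rwa [← Set.range_comp] at h2
  · set C : ℝ := (((m + 1 : ℕ) : ℝ) * ((m + 1 : ℕ) : ℝ)) *
      (2 * ((((m + 1 : ℕ) : ℝ) + 1) * 2) * μ.meas.real Set.univ) with hC
    have hlim : Tendsto (fun i : ℕ => C * (1 / ((i : ℝ) + 1))) atTop (𝓝 0) := by
      simpa using tendsto_one_div_add_atTop_nhds_zero_nat.const_mul C
    refine squeeze_zero' (Eventually.of_forall fun i => Metric.infDist_nonneg) ?_ hlim
    filter_upwards [eventually_gt_atTop m, eventually_gt_atTop l] with i hm hl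
    obtain ⟨Y, hYm, hYd⟩ := hY i (⟨m, hm⟩, ⟨l, hl⟩)
    refine (Metric.infDist_le_dist_of_mem (y := Y) hYm).trans ?_
    rw [hfx]
    refine hYd.trans (le_of_eq ?_)
    simp only [hC]
    ring

/-! ### The shape distance -/

theorem norm_le_of_mem_shape {c : ℝ≥0} {μ : SymMeasure c} {k : ℕ} [NeZero k] {Y : EllOneMat k}
    (hY : Y ∈ (shape μ.meas k : Set (EllOneMat k))) : ‖Y‖ ≤ c := by
  rw [coe_shape] at hY
  exact (norm_le_of_mem_closure_weightedShape hY).trans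
    (ENNReal.toReal_le_of_le_ofReal c.2 (by simpa using! μ.2.2))

theorem dist_shape_le {c : ℝ≥0} (μ₁ μ₂ : SymMeasure c) (k : ℕ) [NeZero k] :
    dist (shape μ₁.meas k) (shape μ₂.meas k) ≤ 2 * c := by
  have hd : ∀ (μ μ' : SymMeasure c), ∀ Y ∈ (shape μ.meas k : Set (EllOneMat k)),
      ∃ Y' ∈ (shape μ'.meas k : Set (EllOneMat k)), dist Y Y' ≤ 2 * c := by
    intro μ μ' Y hY
    obtain ⟨Y', hY'⟩ := (shape μ'.meas k).nonempty
    refine ⟨Y', hY', (dist_le_norm_add_norm Y Y').trans ?_⟩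
    linarith [norm_le_of_mem_shape hY, norm_le_of_mem_shape hY']
  rw [Metric.NonemptyCompacts.dist_eq]
  exact Metric.hausdorffDist_le_of_mem_dist (by positivity) (hd μ₁ μ₂) (hd μ₂ μ₁)

theorem summable_shapeDist_bound (c : ℝ≥0) :
    Summable fun m : ℕ => 1 / (2 : ℝ) ^ (m + 1) * (2 * c) := by
  refine Summable.mul_right _ ?_
  have := (summable_nat_add_iff 1).2 summable_geometric_two
  simpa using this

theorem shapeDistTerm_nonneg {c : ℝ≥0} (μ₁ μ₂ : SymMeasure c) (m : ℕ) :
    0 ≤ shapeDistTerm μ₁ μ₂ m :=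
  mul_nonneg (by positivity) dist_nonneg

theorem shapeDistTerm_le {c : ℝ≥0} (μ₁ μ₂ : SymMeasure c) (m : ℕ) :
    shapeDistTerm μ₁ μ₂ m ≤ 1 / (2 : ℝ) ^ (m + 1) * (2 * c) :=
  mul_le_mul_of_nonneg_left (dist_shape_le μ₁ μ₂ _) (by positivity)

theorem summable_shapeDistTerm {c : ℝ≥0} (μ₁ μ₂ : SymMeasure c) :
    Summable (shapeDistTerm μ₁ μ₂) :=
  Summable.of_nonneg_of_le (shapeDistTerm_nonneg μ₁ μ₂) (shapeDistTerm_le μ₁ μ₂)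
    (summable_shapeDist_bound c)

/-- The pseudometric on symmetric measures given by the shape distance. -/
abbrev shapePseudoMetric (c : ℝ≥0) : PseudoMetricSpace (SymMeasure c) where
  dist := shapeDist
  dist_self μ := by simp [shapeDist, shapeDistTerm]
  dist_comm μ₁ μ₂ := by simp [shapeDist, shapeDistTerm, dist_comm]
  dist_triangle μ₁ μ₂ μ₃ := by
    rw [shapeDist, shapeDist, shapeDist,
      ← (summable_shapeDistTerm μ₁ μ₂).tsum_add (summable_shapeDistTerm μ₂ μ₃)]
    refine (summable_shapeDistTerm μ₁ μ₃).tsum_le_tsum (fun m => ?_)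
      ((summable_shapeDistTerm μ₁ μ₂).add (summable_shapeDistTerm μ₂ μ₃))
    rw [shapeDistTerm, shapeDistTerm, shapeDistTerm, ← mul_add]
    exact mul_le_mul_of_nonneg_left (dist_triangle _ _ _) (by positivity)

/-- If all shapes converge, then so does the shape distance, by dominated convergence. -/
theorem tendsto_shapeDist {ι : Type*} {l : Filter ι} {c : ℝ≥0} {μs : ι → SymMeasure c}
    {μ : SymMeasure c}
    (h : ∀ m : ℕ, Tendsto (fun i => shape (μs i).meas (m + 1)) l (𝓝 (shape μ.meas (m + 1)))) :
    Tendsto (fun i => shapeDist (μs i) μ) l (𝓝 0) := by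
  have h0 : (0 : ℝ) = ∑' _ : ℕ, 0 := tsum_zero.symm
  rw [h0]
  refine tendsto_tsum_of_dominated_convergence (summable_shapeDist_bound c) (fun m => ?_)
    (Eventually.of_forall fun i m => ?_)
  · simpa [shapeDistTerm] using (tendsto_iff_dist_tendsto_zero.1 (h m)).const_mul
      (1 / (2 : ℝ) ^ (m + 1))
  · rw [Real.norm_eq_abs, abs_of_nonneg (shapeDistTerm_nonneg _ _ _)]
    exact shapeDistTerm_le _ _ _

/-- The shapes of all the measures lie in a fixed ball, so along any ultrafilter they converge. -/
theorem exists_tendsto_shape {c : ℝ≥0} (𝓕 : Ultrafilter (SymMeasure c)) (k : ℕ) [NeZero k] :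
    ∃ L : NonemptyCompacts (EllOneMat k),
      Tendsto (fun μ : SymMeasure c => shape μ.meas k) 𝓕 (𝓝 L) := by
  have : ProperSpace (EllOneMat k) := FiniteDimensional.proper ℝ _
  obtain ⟨L, -, hL⟩ := (NonemptyCompacts.isCompact_subsets_of_isCompact
    (isCompact_closedBall (0 : EllOneMat k) c)).ultrafilter_le_nhds (𝓕.map
      fun μ : SymMeasure c => shape μ.meas k)
    (tendsto_principal.2 (Eventually.of_forall fun μ Y hY =>
      mem_closedBall_zero_iff.2 (norm_le_of_mem_shape hY)))
  exact ⟨L, hL⟩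

theorem compactSpace_shapePseudoMetric (c : ℝ≥0) :
    @CompactSpace (SymMeasure c) (shapePseudoMetric c).toUniformSpace.toTopologicalSpace := by
  let := shapePseudoMetric c
  refine ⟨isCompact_iff_ultrafilter_le_nhds.2 fun 𝓕 _ => ?_⟩
  choose L hL using fun m : ℕ => exists_tendsto_shape 𝓕 (m + 1)
  obtain ⟨μ, hμ⟩ := exists_symMeasure_shape_eq 𝓕 (fun μ => μ) L hL
  refine ⟨μ, Set.mem_univ _, ?_⟩
  have h : Tendsto (fun μ' : SymMeasure c => shapeDist μ' μ) 𝓕 (𝓝 0) :=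
    tendsto_shapeDist fun m => by rw [hμ]; exact hL m
  exact tendsto_iff_dist_tendsto_zero.2 h

/-- A shape convergent sequence of matrices of bounded mass has a limit measure. -/
theorem ShapeConvergent.exists_shapeTendsto {c : ℝ≥0} {n : ℕ → ℕ}
    {S : ∀ i, Matrix (Fin (n i)) (Fin (n i)) ℝ} (hn : ∀ i, 0 < n i)
    (hS : ∀ i, IsSymmNonneg (S i)) (hc : ∀ i, entrySum (S i) ≤ (c : ℝ)) (h : ShapeConvergent S) :
    ∃ μ : SymMeasure c, ShapeTendsto S μ := by
  choose μs hμs using fun i => exists_symMeasure_shape_eq_matrixShape (hn i) (hS i) (hc i)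
  choose L hL using fun m : ℕ => h (m + 1)
  obtain ⟨μ, hμ⟩ := exists_symMeasure_shape_eq (Ultrafilter.of atTop) μs L fun m => by
    simp_rw [hμs]
    exact (hL m).mono_left (Ultrafilter.of_le atTop)
  refine ⟨μ, fun k hk => ?_⟩
  obtain ⟨m, rfl⟩ := Nat.exists_eq_succ_of_ne_zero hk.out
  have h1 := hL m
  rw [← hμ] at h1
  exact h1

end ShapeSpace

end

theorem mainTheorem7 (c : ℝ≥0) :
    (∀ μ₁ μ₂ : ShapeSpace.SymMeasure c, Summable (ShapeSpace.shapeDistTerm μ₁ μ₂)) ∧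
    (∃ P : PseudoMetricSpace (ShapeSpace.SymMeasure c),
      (∀ μ₁ μ₂ : ShapeSpace.SymMeasure c, dist μ₁ μ₂ = ShapeSpace.shapeDist μ₁ μ₂) ∧
      (∀ μ₁ μ₂ : ShapeSpace.SymMeasure c,
        (SeparationQuotient.mk μ₁ = SeparationQuotient.mk μ₂ ↔
          ShapeSpace.shapeDist μ₁ μ₂ = 0) ∧
        dist (SeparationQuotient.mk μ₁) (SeparationQuotient.mk μ₂) =
          ShapeSpace.shapeDist μ₁ μ₂) ∧
      CompactSpace (SeparationQuotient (ShapeSpace.SymMeasure c)) ∧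
      T2Space (SeparationQuotient (ShapeSpace.SymMeasure c))) ∧
    (∀ (n : ℕ → ℕ) (S : ∀ i, Matrix (Fin (n i)) (Fin (n i)) ℝ),
      (∀ i, 0 < n i) → (∀ i, ShapeSpace.IsSymmNonneg (S i)) →
      (∀ i, ShapeSpace.entrySum (S i) ≤ (c : ℝ)) → ShapeSpace.ShapeConvergent S →
      ∃ μ : ShapeSpace.SymMeasure c, ShapeSpace.ShapeTendsto S μ) ∧
    (∀ μ : ShapeSpace.SymMeasure c,
      ∃ (n : ℕ → ℕ) (S : ∀ i, Matrix (Fin (n i)) (Fin (n i)) ℝ),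
        (∀ i, 0 < n i) ∧ (∀ i, ShapeSpace.IsSymmNonneg (S i)) ∧
        (∀ i, ShapeSpace.entrySum (S i) = μ.meas.real Set.univ) ∧
        ShapeSpace.ShapeTendsto S μ) := by
  refine ⟨ShapeSpace.summable_shapeDistTerm, ?_, fun n S hn hS hc h =>
    h.exists_shapeTendsto hn hS hc, ShapeSpace.exists_shapeTendsto⟩
  let P := ShapeSpace.shapePseudoMetric c
  have hcomp : CompactSpace (ShapeSpace.SymMeasure c) := ShapeSpace.compactSpace_shapePseudoMetric c
  refine ⟨P, fun _ _ => rfl, fun μ₁ μ₂ => ⟨?_, rfl⟩, Quotient.compactSpace, inferInstance⟩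
  rw [SeparationQuotient.mk_eq_mk, Metric.inseparable_iff]
  rfl
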